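/- Let $\mathbb F$ be a field and let $(C,d,\mathcal F)$ be a filtered chain complex over $\mathbb F$: a chain complex $(C_n)_{n\in\mathbb Z}$ of $\mathbb F$-spaces with $d(C_n)\subset C_{n-1}$ and an ascending filtration $(\mathcal F^pC_n)_{p\in\mathbb Z}$ of each $C_n$ with $d(\mathcal F^pC_n)\subset\mathcal F^pC_{n-1}$. Let $PC=\bigoplus_{p\in\mathbb Z}\mathcal F^pC$ be its persistent chain complex, a complex of graded $\mathbb F[x]$-modules on which $x$ acts by the inclusions $\mathcal F^pC\hookrightarrow\mathcal F^{p+1}C$, and let $PH=H(PC)$ be the persistent homology. For a chain complex $K$ of graded $\mathbb F[x]$-modules on which $x$ acts injectively, let $\{E^{(r)}(K)\}_{r\ge1}$ be the spectral sequence of the exact couple $$H(K)\xrightarrow{\ x\ }H(K)\xrightarrow{(\pi_x)_*}H(K/xK)\xrightarrow{\ \Delta\ }H(K)$$ of $0\to K\{1\}\xrightarrow{x}K\xrightarrow{\pi_x}K/xK\to0$; that is, $E^{(r)}(K)$ is the $E$-term of this couple derived $r-1$ times, and $E^{(\infty)}(K)=Z^\infty/B^\infty$, where $Z^\infty\subset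 E^{(1)}(K)$ consists of the elements that survive to every page and $B^\infty$ of those that become $0$ on some page. All of these are bigraded by the homological grading and the $\mathbb F[x]$-grading. The spectral sequence of $(C,d,\mathcal F)$ is $E^{(r)}=E^{(r)}(PC)$. Write $M\|n\|\{s\}$ for $M$ placed in homological degree $n$ with its $\mathbb F[x]$-grading shifted up by $s$. For $n,s\in\mathbb Z$ put $$U_{n,s,\infty}=\bigl(0\to\mathbb F[x]\|n\|\{s\}\to0\bigr),\qquad U_{n,s,m}=\bigl(0\to\mathbb F[x]\|n+1\|\{s+m\}\xrightarrow{x^m}\mathbb F[x]\|n\|\{s\}\to0\bigr)\quad(1\le m<\infty).$$ Assume that for each $n$ there is a $p$ with $\mathcal F^pC_n=0$, and that $\dim_{\mathbb F}\mathcal F^pC_n<\infty$ for all $n$ and $p$. Then: 1. For each $n\in\mathbb Z$ there are a length $K_n\in\{0,1,2,\dots\}\cup\{\infty\}$ and a sequence $(s_n(i),m_n(i))_{i=1}^{K_n}$ in $\mathbb Z\times\{1,2,\dots,\infty\}$ such that $\{i: s_n(i)=s\}$ is finite for every $s$, $s_n(i)\le s_n(i+1)$, and $m_n(i)\le m_n(i+1)$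 whenever $s_n(i)=s_n(i+1)$, together with an isomorphism of bigraded $\mathbb F[x]$-modules $$\Phi:\ PH\ \cong\ \bigoplus_{n\in\mathbb Z}\bigoplus_{i=1}^{K_n}H\bigl(U_{n,s_n(i),m_n(i)}\bigr).$$ 2. Every such decomposition $\Phi$ induces a direct sum decomposition of the spectral sequence: there are isomorphisms of bigraded $\mathbb F$-spaces $$\Psi^{(r)}:\ E^{(r)}\ \cong\ \bigoplus_{n\in\mathbb Z}\bigoplus_{i=1}^{K_n}E^{(r)}\bigl(U_{n,s_n(i),m_n(i)}\bigr)\qquad(1\le r\le\infty)$$ which for $r<\infty$ commute with the differentials, such that $\Psi^{(r+1)}$ is induced by $\Psi^{(r)}$ on homology, $\Psi^{(\infty)}$ is induced by $\Psi^{(1)}$, and $(\Phi,\Psi^{(1)})$ commutes with the maps $(\pi_x)_*$ and $\Delta$ of the exact couples. 3. For all $n,s\in\mathbb Z$, as bigraded $\mathbb F$-spaces, $E^{(r)}(U_{n,s,\infty})\cong\mathbb F\|n\|\{s\}$ for all $r\ge1$, and $E^{(\infty)}(U_{n,s,\infty})\cong\mathbb F\|n\|\{s\}$. 4. For all $n,s\in\mathbb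 Z$ and $1\le m<\infty$, as bigraded $\mathbb F$-spaces, $$E^{(r)}(U_{n,s,m})\cong\begin{cases}\mathbb F\|n+1\|\{s+m\}\oplus\mathbb F\|n\|\{s\}&\text{for }1\le r\le m,\\0&\text{for }r>m,\end{cases}$$ and $E^{(\infty)}(U_{n,s,m})\cong0$. -/

import Mathlib

open Polynomial

universe u v w

namespace PHSS

/-! ### Bigraded vector spaces

A bigraded `F`-space is an `F`-space `V` with a family `G : ℤ × ℤ → Submodule F V` such that `V` is
the internal direct sum of the `G i`.  The index `(n, p)` consists of the homological grading `n`
and the polynomial (filtration) grading `p`. -/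

section Grading

variable {F : Type u} [Field F] {V : Type v} [AddCommGroup V] [Module F V]
  {W : Type w} [AddCommGroup W] [Module F W]

/-- A bigraded space as the direct sum of its components. -/
noncomputable def compEquiv {G : ℤ × ℤ → Submodule F V} (hG : DirectSum.IsInternal G) :
    (DirectSum (ℤ × ℤ) fun i => G i) ≃ₗ[F] V :=
  LinearEquiv.ofBijective (DirectSum.coeLinearMap G) hG

/-- The projection of a graded space to a homogeneous component. -/
noncomputable def proj {G : ℤ × ℤ → Submodule F V} (hG : DirectSum.IsInternal G) (i : ℤ × ℤ) :
    V →ₗ[F] V :=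
  (G i).subtype ∘ₗ DirectSum.component F (ℤ × ℤ) (fun i => G i) i ∘ₗ
    (compEquiv hG).symm.toLinearMap

theorem proj_mem {G : ℤ × ℤ → Submodule F V} (hG : DirectSum.IsInternal G) (i : ℤ × ℤ) (v : V) :
    proj hG i v ∈ G i := by
  exact (DirectSum.component F (ℤ × ℤ) (fun i => G i) i ((compEquiv hG).symm v)).2

theorem proj_of_mem {G : ℤ × ℤ → Submodule F V} (hG : DirectSum.IsInternal G) {i : ℤ × ℤ} {v : V}
    (hv : v ∈ G i) (j : ℤ × ℤ) : proj hG j v = if i = j then v else 0 := by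
  have : (compEquiv hG).symm v =
      DirectSum.lof F (ℤ × ℤ) (fun i => G i) i ⟨v, hv⟩ := by
    rw [LinearEquiv.symm_apply_eq]
    exact (DirectSum.coeLinearMap_lof G i ⟨v, hv⟩).symm
  simp only [proj, LinearMap.comp_apply, LinearEquiv.coe_coe, this, Submodule.subtype_apply]
  split_ifs with h
  · subst h
    simp [DirectSum.component.lof_self]
  · simp [DirectSum.component.of, h]

theorem homogeneous_induction {G : ℤ × ℤ → Submodule F V} (hG : DirectSum.IsInternal G)
    {P : V → Prop} (v : V) (hm : ∀ i, ∀ v ∈ G i, P v) (h0 : P 0)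
    (ha : ∀ v w, P v → P w → P (v + w)) : P v := by
  have hv : v ∈ ⨆ i, G i := by rw [hG.submodule_iSup_eq_top]; trivial
  exact Submodule.iSup_induction G (motive := P) hv hm h0 ha

theorem proj_map {G : ℤ × ℤ → Submodule F V} (hG : DirectSum.IsInternal G)
    {H : ℤ × ℤ → Submodule F W} (hH : DirectSum.IsInternal H) (T : V →ₗ[F] W) (δ : ℤ × ℤ)
    (hT : ∀ i, ∀ v ∈ G i, T v ∈ H (i + δ)) (i : ℤ × ℤ) (v : V) :
    proj hH (i + δ) (T v) = T (proj hG i v) := by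
  refine homogeneous_induction hG (P := fun v => proj hH (i + δ) (T v) = T (proj hG i v)) v ?_ ?_ ?_
  · intro j v hv
    rw [proj_of_mem hG hv, proj_of_mem hH (hT j v hv)]
    by_cases h : j = i <;> simp [h]
  · simp
  · intro v w hv hw
    simp [hv, hw]

theorem isInternal_of_proj {G : ℤ × ℤ → Submodule F V} (π : ℤ × ℤ → V →ₗ[F] V)
    (h : ∀ i j, ∀ v ∈ G i, π j v = if i = j then v else 0) (htop : ⨆ i, G i = ⊤) :
    DirectSum.IsInternal G := by
  refine DirectSum.isInternal_submodule_of_iSupIndep_of_iSup_eq_top ?_ htop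
  intro i
  rw [Submodule.disjoint_def]
  intro v hv hv'
  have hle : (⨆ j, ⨆ _ : j ≠ i, G j) ≤ LinearMap.ker (π i) := by
    refine iSup_le fun j => iSup_le fun hj => fun w hw => ?_
    rw [LinearMap.mem_ker, h j i w hw, if_neg hj]
  have h1 := hle hv'
  rw [LinearMap.mem_ker, h i i v hv, if_pos rfl] at h1
  exact h1

/-- A subspace that contains the components of its elements is graded. -/
theorem isInternal_comap {G : ℤ × ℤ → Submodule F V} (hG : DirectSum.IsInternal G)
    (j : W →ₗ[F] V) (hj : Function.Injective j)
    (hs : ∀ i w, ∃ w', j w' = proj hG i (j w)) :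
    DirectSum.IsInternal (fun i => (G i).comap j) := by
  choose q hq using hs
  let π : ℤ × ℤ → W →ₗ[F] W := fun i =>
    { toFun := q i
      map_add' := fun a b => hj (by simp [hq])
      map_smul' := fun a b => hj (by simp [hq]) }
  have hπ : ∀ i w, j (π i w) = proj hG i (j w) := hq
  refine isInternal_of_proj π ?_ ?_
  · intro i k v hv
    apply hj
    rw [hπ, proj_of_mem hG (i := i) hv]
    split_ifs <;> simp
  · rw [eq_top_iff]
    intro w _
    have key : ∀ v : V, ∃ s : Finset (ℤ × ℤ), ∀ t, s ⊆ t → v = ∑ i ∈ t, proj hG i v := by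
      intro v
      refine homogeneous_induction hG
        (P := fun v => ∃ s : Finset (ℤ × ℤ), ∀ t, s ⊆ t → v = ∑ i ∈ t, proj hG i v) v ?_ ?_ ?_
      · intro i v hv
        refine ⟨{i}, fun t ht => ?_⟩
        have : i ∈ t := ht (by simp)
        simp [proj_of_mem hG hv, this]
      · exact ⟨∅, by simp⟩
      · classical
        rintro a b ⟨s, hs⟩ ⟨t, ht⟩
        refine ⟨s ∪ t, fun r hr => ?_⟩
        simp only [map_add, Finset.sum_add_distrib]
        rw [← hs r (Finset.union_subset_left hr), ← ht r (Finset.union_subset_right hr)]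
    obtain ⟨s, hs⟩ := key (j w)
    have hw : w = ∑ i ∈ s, π i w := by
      apply hj
      rw [map_sum]
      simp only [hπ]
      exact hs s subset_rfl
    rw [hw]
    refine Submodule.sum_mem _ fun i _ => ?_
    refine Submodule.mem_iSup_of_mem i ?_
    rw [Submodule.mem_comap, hπ]
    exact proj_mem hG i _

/-- A quotient by a subspace that contains the components of its elements is graded. -/
theorem isInternal_map {G : ℤ × ℤ → Submodule F V} (hG : DirectSum.IsInternal G)
    (q : V →ₗ[F] W) (hq : Function.Surjective q)
    (hs : ∀ i v, q v = 0 → q (proj hG i v) = 0) :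
    DirectSum.IsInternal (fun i => (G i).map q) := by
  have hs' : ∀ i a b, q a = q b → q (proj hG i a) = q (proj hG i b) := by
    intro i a b hab
    rw [← sub_eq_zero, ← map_sub, ← map_sub]
    exact hs i _ (by rw [map_sub, hab, sub_self])
  choose r hr using hq
  let π : ℤ × ℤ → W →ₗ[F] W := fun i =>
    { toFun := fun w => q (proj hG i (r w))
      map_add' := fun a b => by
        rw [← map_add, ← map_add]
        exact hs' i _ _ (by simp [hr])
      map_smul' := fun c a => by
        rw [RingHom.id_apply, ← map_smul, ← map_smul]
        exact hs' i _ _ (by simp [hr]) }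
  refine isInternal_of_proj π ?_ ?_
  · rintro i k _ ⟨v, hv, rfl⟩
    change q (proj hG k (r (q v))) = _
    rw [hs' k _ v (hr _), proj_of_mem hG (i := i) hv]
    split_ifs <;> simp
  · rw [← Submodule.map_iSup, hG.submodule_iSup_eq_top, Submodule.map_top, LinearMap.range_eq_top]
    exact fun w => ⟨r w, hr w⟩

/-- Isomorphism of bigraded `F`-spaces. -/
def BigradedIso (G : ℤ × ℤ → Submodule F V) (H : ℤ × ℤ → Submodule F W) : Prop :=
  ∃ e : V ≃ₗ[F] W, ∀ i, (G i).map e.toLinearMap = H i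

/-- The bigrading of a direct sum of bigraded spaces. -/
def sumGr {ι : Type*} {M : ι → Type*} [∀ a, AddCommGroup (M a)] [∀ a, Module F (M a)]
    (G : ∀ a, ℤ × ℤ → Submodule F (M a)) (i : ℤ × ℤ) : Submodule F (DirectSum ι M) :=
  ⨅ a, (G a i).comap (DirectSum.component F ι M a)

/-- The bigrading of `𝔽‖n‖{s}`: the space `F`, placed in bidegree `(n, s)`. -/
def lineGr (F : Type u) [Field F] (n s : ℤ) (i : ℤ × ℤ) : Submodule F F :=
  if i = (n, s) then ⊤ else ⊥

end Grading

/-- The linear map determined by a functional linear relation. -/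
noncomputable def linOfRel {F : Type u} [Field F] {V : Type v} [AddCommGroup V] [Module F V]
    {W : Type w} [AddCommGroup W] [Module F W] (R : Submodule F (V × W))
    (htot : ∀ v, ∃ w, (v, w) ∈ R) (hfun : ∀ w, (0, w) ∈ R → w = 0) : V →ₗ[F] W :=
  have uniq : ∀ {v w w'}, (v, w) ∈ R → (v, w') ∈ R → w = w' := fun {v w w'} h h' =>
    sub_eq_zero.1 (hfun _ (by simpa using R.sub_mem h h'))
  { toFun := fun v => (htot v).choose
    map_add' := fun a b => uniq (htot (a + b)).choose_spec
      (by simpa using R.add_mem (htot a).choose_spec (htot b).choose_spec)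
    map_smul' := fun c a => uniq (htot (c • a)).choose_spec
      (by simpa using R.smul_mem c (htot a).choose_spec) }

theorem linOfRel_eq {F : Type u} [Field F] {V : Type v} [AddCommGroup V] [Module F V]
    {W : Type w} [AddCommGroup W] [Module F W] (R : Submodule F (V × W))
    (htot : ∀ v, ∃ w, (v, w) ∈ R) (hfun : ∀ w, (0, w) ∈ R → w = 0) {v : V} {w : W}
    (h : (v, w) ∈ R) : linOfRel R htot hfun v = w :=
  sub_eq_zero.1 (hfun _ (by
    have := R.sub_mem (htot v).choose_spec h
    rw [Prod.mk_sub_mk, sub_self] at this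
    exact this))

/-! ### Homology of a module with differential -/

section Homology

variable {R : Type u} [CommRing R] {M : Type v} [AddCommGroup M] [Module R M]
  {N : Type w} [AddCommGroup N] [Module R N]

/-- The homology `ker d / im d`. -/
abbrev DHomology (d : M →ₗ[R] M) : Type v :=
  LinearMap.ker d ⧸ (LinearMap.range d).submoduleOf (LinearMap.ker d)

/-- The homology class of a cycle. -/
def DHomology.mk (d : M →ₗ[R] M) : LinearMap.ker d →ₗ[R] DHomology d :=
  ((LinearMap.range d).submoduleOf (LinearMap.ker d)).mkQ

theorem DHomology.mk_surjective (d : M →ₗ[R] M) : Function.Surjective (DHomology.mk d) :=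
  Submodule.mkQ_surjective _

theorem DHomology.mk_eq_zero (d : M →ₗ[R] M) (z : LinearMap.ker d) :
    DHomology.mk d z = 0 ↔ ∃ y, d y = z := by
  rw [DHomology.mk, Submodule.mkQ_apply, Submodule.Quotient.mk_eq_zero]
  exact Iff.rfl

/-- The map induced on homology by a map commuting with the differentials. -/
def DHomology.map {d : M →ₗ[R] M} {d' : N →ₗ[R] N} (φ : M →ₗ[R] N)
    (h : ∀ m, φ (d m) = d' (φ m)) : DHomology d →ₗ[R] DHomology d' :=
  Submodule.mapQ _ _
    (φ.restrict (p := LinearMap.ker d) (q := LinearMap.ker d') fun m hm => by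
      rw [LinearMap.mem_ker, ← h, LinearMap.mem_ker.1 hm, map_zero])
    (by
      rintro ⟨z, hz⟩ ⟨y, hy⟩
      exact ⟨φ y, by rw [← h, hy]; rfl⟩)

theorem DHomology.map_mk {d : M →ₗ[R] M} {d' : N →ₗ[R] N} (φ : M →ₗ[R] N)
    (h : ∀ m, φ (d m) = d' (φ m)) (z : LinearMap.ker d) (z' : LinearMap.ker d')
    (hz : (z' : N) = φ z) : DHomology.map φ h (DHomology.mk d z) = DHomology.mk d' z' := by
  have : z' = (φ.restrict (p := LinearMap.ker d) (q := LinearMap.ker d') fun m hm => by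
      rw [LinearMap.mem_ker, ← h, LinearMap.mem_ker.1 hm, map_zero]) z := Subtype.ext hz
  rw [this]
  rfl

variable {F : Type*} [Field F] [Module F M] [SMul F R] [IsScalarTower F R M]

/-- The bigrading on homology: the homogeneous elements of degree `i` are the classes of the
cycles that are homogeneous of degree `i`. -/
def DHomology.gr (d : M →ₗ[R] M) (G : ℤ × ℤ → Submodule F M) (i : ℤ × ℤ) :
    Submodule F (DHomology d) :=
  ((G i).comap ((LinearMap.ker d).subtype.restrictScalars F)).map
    ((DHomology.mk d).restrictScalars F)

theorem DHomology.mem_gr {d : M →ₗ[R] M} {G : ℤ × ℤ → Submodule F M} {i : ℤ × ℤ}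
    {y : DHomology d} :
    y ∈ DHomology.gr d G i ↔ ∃ z : LinearMap.ker d, (z : M) ∈ G i ∧ DHomology.mk d z = y :=
  Iff.rfl

theorem DHomology.gr_isInternal (d : M →ₗ[R] M)
    {G : ℤ × ℤ → Submodule F M} (hG : DirectSum.IsInternal G) (δ : ℤ × ℤ)
    (hδ : ∀ i, ∀ m ∈ G i, d m ∈ G (i + δ)) : DirectSum.IsInternal (DHomology.gr d G) := by
  have hp : ∀ i m, d (proj hG i m) = proj hG (i + δ) (d m) := fun i m =>
    (proj_map hG hG (d.restrictScalars F) δ hδ i m).symm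
  have h1 := isInternal_comap hG ((LinearMap.ker d).subtype.restrictScalars F)
    (Submodule.injective_subtype _) (by
      rintro i ⟨z, hz⟩
      refine ⟨⟨proj hG i z, ?_⟩, rfl⟩
      rw [LinearMap.mem_ker, hp, LinearMap.mem_ker.1 hz, map_zero])
  have h2 : ∀ i (z : LinearMap.ker d), ((proj h1 i z : LinearMap.ker d) : M) = proj hG i z := by
    intro i z
    have := proj_map h1 hG ((LinearMap.ker d).subtype.restrictScalars F) 0
      (fun i v hv => by simpa using hv) i z
    simpa using this.symm
  refine isInternal_map h1 ((DHomology.mk d).restrictScalars F) (DHomology.mk_surjective d) ?_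
  intro i z hz
  obtain ⟨y, hy⟩ := (DHomology.mk_eq_zero d z).1 hz
  refine (DHomology.mk_eq_zero d _).2 ⟨proj hG (i - δ) y, ?_⟩
  rw [hp, h2, hy, sub_add_cancel]

end Homology

/-! ### Exact couples -/

/-- An exact couple of bigraded `F`-spaces and homogeneous maps. -/
structure ExactCouple (F : Type u) [Field F] : Type (max u (v + 1)) where
  A : Type v
  E : Type v
  [acgA : AddCommGroup A]
  [modA : Module F A]
  [acgE : AddCommGroup E]
  [modE : Module F E]
  f : A →ₗ[F] A
  g : A →ₗ[F] E
  h : E →ₗ[F] A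
  exact_fg : Function.Exact f g
  exact_gh : Function.Exact g h
  exact_hf : Function.Exact h f
  grA : ℤ × ℤ → Submodule F A
  grE : ℤ × ℤ → Submodule F E
  grA_isInternal : DirectSum.IsInternal grA
  grE_isInternal : DirectSum.IsInternal grE
  degF : ℤ × ℤ
  degG : ℤ × ℤ
  degH : ℤ × ℤ
  f_mem : ∀ i, ∀ a ∈ grA i, f a ∈ grA (i + degF)
  g_mem : ∀ i, ∀ a ∈ grA i, g a ∈ grE (i + degG)
  h_mem : ∀ i, ∀ e ∈ grE i, h e ∈ grA (i + degH)

namespace ExactCouple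

attribute [instance] acgA modA acgE modE

variable {F : Type u} [Field F] (c : ExactCouple.{u, v} F)

/-- The differential `d = g ∘ h` on `E`. -/
def d : c.E →ₗ[F] c.E := c.g ∘ₗ c.h

theorem d_d (e : c.E) : c.d (c.d e) = 0 := by
  simp [d, c.exact_gh.apply_apply_eq_zero]

theorem d_mem (i : ℤ × ℤ) (e : c.E) (he : e ∈ c.grE i) : c.d e ∈ c.grE (i + (c.degH + c.degG)) := by
  rw [← add_assoc]
  exact c.g_mem _ _ (c.h_mem _ _ he)

/-- The relation `f a ↦ [g a]` defining the map `g'` of the derived couple. -/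
def relG : Submodule F (LinearMap.range c.f × DHomology c.d) where
  carrier := {q | ∃ (a : c.A) (z : LinearMap.ker c.d),
    c.f a = q.1 ∧ (z : c.E) = c.g a ∧ DHomology.mk c.d z = q.2}
  zero_mem' := ⟨0, 0, by simp, by simp, by simp⟩
  add_mem' := by
    rintro _ _ ⟨a, z, h1, h2, h3⟩ ⟨a', z', h1', h2', h3'⟩
    exact ⟨a + a', z + z', by simp [h1, h1'], by simp [h2, h2'], by simp [h3, h3']⟩
  smul_mem' := by
    rintro t _ ⟨a, z, h1, h2, h3⟩
    exact ⟨t • a, t • z, by simp [h1], by simp [h2], by simp [h3]⟩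

theorem g_mem_ker (a : c.A) : c.g a ∈ LinearMap.ker c.d := by
  simp [d, c.exact_gh.apply_apply_eq_zero]

theorem mem_relG (a : c.A) (x : LinearMap.range c.f) (hx : (x : c.A) = c.f a) :
    (x, DHomology.mk c.d ⟨c.g a, c.g_mem_ker a⟩) ∈ c.relG :=
  ⟨a, _, hx.symm, rfl, rfl⟩

theorem relG_total (x : LinearMap.range c.f) : ∃ y, (x, y) ∈ c.relG := by
  obtain ⟨a, ha⟩ := x.2
  exact ⟨_, c.mem_relG a x ha.symm⟩

theorem relG_fun (y : DHomology c.d) (hy : (0, y) ∈ c.relG) : y = 0 := by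
  obtain ⟨a, z, h1, h2, rfl⟩ := hy
  obtain ⟨e, rfl⟩ := (c.exact_hf a).1 h1
  exact (DHomology.mk_eq_zero c.d z).2 ⟨e, h2.symm⟩

/-- `g' (f a) = [g a]`. -/
noncomputable def g' : LinearMap.range c.f →ₗ[F] DHomology c.d :=
  linOfRel c.relG c.relG_total c.relG_fun

theorem g'_apply (a : c.A) (x : LinearMap.range c.f) (hx : (x : c.A) = c.f a) :
    c.g' x = DHomology.mk c.d ⟨c.g a, c.g_mem_ker a⟩ :=
  linOfRel_eq _ _ _ (c.mem_relG a x hx)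

theorem h_mem_range (z : LinearMap.ker c.d) : c.h z ∈ LinearMap.range c.f := by
  have : c.g (c.h z) = 0 := z.2
  exact (c.exact_fg _).1 this

/-- `h' [e] = h e`. -/
def h' : DHomology c.d →ₗ[F] LinearMap.range c.f :=
  Submodule.liftQ _ ((c.h.domRestrict (LinearMap.ker c.d)).codRestrict _ c.h_mem_range) (by
    rintro z ⟨y, hy⟩
    rw [LinearMap.mem_ker]
    apply Subtype.ext
    change c.h z = 0
    have : (z : c.E) = c.g (c.h y) := hy.symm
    rw [this, c.exact_gh.apply_apply_eq_zero])

theorem h'_mk (z : LinearMap.ker c.d) : (c.h' (DHomology.mk c.d z) : c.A) = c.h z := rfl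

/-- `f' = f` restricted to `A' = im f`. -/
def f' : LinearMap.range c.f →ₗ[F] LinearMap.range c.f :=
  c.f.restrict fun x _ => ⟨x, rfl⟩

theorem f'_coe (x : LinearMap.range c.f) : (c.f' x : c.A) = c.f x := rfl

/-- The derived couple. -/
noncomputable def derived : ExactCouple.{u, v} F where
  A := LinearMap.range c.f
  E := DHomology c.d
  f := c.f'
  g := c.g'
  h := c.h'
  exact_fg := by
    rintro ⟨x, a, rfl⟩
    rw [c.g'_apply a _ rfl, DHomology.mk_eq_zero]
    constructor
    · rintro ⟨y, hy⟩
      have : c.g (a - c.h y) = 0 := by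
        rw [map_sub, sub_eq_zero]
        exact hy.symm
      obtain ⟨b, hb⟩ := (c.exact_fg _).1 this
      refine ⟨⟨c.f b, b, rfl⟩, Subtype.ext ?_⟩
      rw [f'_coe]
      change c.f (c.f b) = c.f a
      rw [hb, map_sub, c.exact_hf.apply_apply_eq_zero, sub_zero]
    · rintro ⟨⟨_, b, rfl⟩, hb⟩
      have hb' : c.f (c.f b) = c.f a := congrArg Subtype.val hb
      have : c.f (a - c.f b) = 0 := by rw [map_sub, hb', sub_self]
      obtain ⟨y, hy⟩ := (c.exact_hf _).1 this
      refine ⟨y, ?_⟩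
      change c.g (c.h y) = c.g a
      rw [hy, map_sub, c.exact_fg.apply_apply_eq_zero, sub_zero]
  exact_gh := by
    intro y
    obtain ⟨z, rfl⟩ := DHomology.mk_surjective c.d y
    constructor
    · intro hz
      have hz' : c.h z = 0 := congrArg Subtype.val hz
      obtain ⟨a, ha⟩ := (c.exact_gh _).1 hz'
      refine ⟨⟨c.f a, a, rfl⟩, ?_⟩
      rw [c.g'_apply a _ rfl]
      congr 1
      exact Subtype.ext ha
    · rintro ⟨⟨_, a, rfl⟩, ha⟩
      rw [c.g'_apply a _ rfl] at ha
      rw [← ha]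
      apply Subtype.ext
      rw [h'_mk]
      exact c.exact_gh.apply_apply_eq_zero a
  exact_hf := by
    intro x
    constructor
    · intro hx
      have hx' : c.f x = 0 := congrArg Subtype.val hx
      obtain ⟨e, he⟩ := (c.exact_hf _).1 hx'
      have hk : e ∈ LinearMap.ker c.d := by
        rw [LinearMap.mem_ker]
        change c.g (c.h e) = 0
        rw [he]
        exact (c.exact_fg _).2 x.2
      exact ⟨DHomology.mk c.d ⟨e, hk⟩, Subtype.ext he⟩
    · rintro ⟨y, rfl⟩
      obtain ⟨z, rfl⟩ := DHomology.mk_surjective c.d y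
      apply Subtype.ext
      rw [f'_coe, h'_mk]
      exact c.exact_hf.apply_apply_eq_zero _
  grA := fun i => (c.grA i).comap (LinearMap.range c.f).subtype
  grE := DHomology.gr c.d c.grE
  grA_isInternal := by
    refine isInternal_comap c.grA_isInternal _ (Submodule.injective_subtype _) ?_
    rintro i ⟨_, a, rfl⟩
    refine ⟨⟨c.f (proj c.grA_isInternal (i - c.degF) a), _, rfl⟩, ?_⟩
    change c.f (proj c.grA_isInternal (i - c.degF) a) = proj c.grA_isInternal i (c.f a)
    rw [← proj_map c.grA_isInternal c.grA_isInternal c.f c.degF c.f_mem, sub_add_cancel]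
  grE_isInternal := DHomology.gr_isInternal c.d c.grE_isInternal _ c.d_mem
  degF := c.degF
  degG := c.degG - c.degF
  degH := c.degH
  f_mem := fun i a ha => c.f_mem i a ha
  g_mem := by
    rintro i ⟨_, a, rfl⟩ ha
    have ha' : c.f a ∈ c.grA i := ha
    have h1 : c.f (proj c.grA_isInternal (i - c.degF) a) = c.f a := by
      rw [← proj_map c.grA_isInternal c.grA_isInternal c.f c.degF c.f_mem, sub_add_cancel,
        proj_of_mem _ ha', if_pos rfl]
    rw [c.g'_apply (proj c.grA_isInternal (i - c.degF) a) _ h1.symm]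
    refine ⟨_, ?_, rfl⟩
    have := c.g_mem _ _ (proj_mem c.grA_isInternal (i - c.degF) a)
    rw [show i - c.degF + c.degG = i + (c.degG - c.degF) by abel] at this
    exact this
  h_mem := by
    rintro i _ ⟨z, hz, rfl⟩
    exact c.h_mem i z hz

/-- The couple derived `k` times. -/
noncomputable def iter : ℕ → ExactCouple.{u, v} F
  | 0 => c
  | k + 1 => (iter k).derived

/-- The class in `E' = H(E, d)` of a cycle in `E`. -/
def toDerived : LinearMap.ker c.d →ₗ[F] c.derived.E := DHomology.mk c.d

/-- The elements of the first page that survive to the page number `k + 1` and represent there an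
element of the given subspace `S`. -/
noncomputable def pull : (k : ℕ) → Submodule F (c.iter k).E → Submodule F c.E
  | 0, S => S
  | k + 1, S => pull k ((S.comap (c.iter k).toDerived).map (LinearMap.ker (c.iter k).d).subtype)

/-- The permanent cycles `Z^∞ = ⋂ Z^r` in the first page. -/
noncomputable def Zinf : Submodule F c.E := ⨅ k, c.pull k ⊤

/-- The eventual boundaries `B^∞ = ⋃ B^r` in the first page. -/
noncomputable def Binf : Submodule F c.E := ⨆ k, c.pull k ⊥

/-- The limit page `E^(∞) = Z^∞ / B^∞`. -/
abbrev Einf : Type v := c.Zinf ⧸ c.Binf.submoduleOf c.Zinf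

/-- The bigrading of `E^(∞)`. -/
noncomputable def grEinf (i : ℤ × ℤ) : Submodule F c.Einf :=
  ((c.grE i).comap c.Zinf.subtype).map (c.Binf.submoduleOf c.Zinf).mkQ

end ExactCouple

/-! ### Chain complexes of graded `F[x]`-modules -/

/-- A chain complex of graded `F[x]`-modules without `x`-torsion (for instance free ones).  The
summand `gr (n, p)` is the homogeneous component of `F[x]`-degree `p` in homological degree `n`. -/
structure GradedComplex (F : Type u) [Field F] : Type (max u (v + 1)) where
  carrier : Type v
  [acg : AddCommGroup carrier]
  [modX : Module F[X] carrier]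
  [mod : Module F carrier]
  [tower : IsScalarTower F F[X] carrier]
  d : carrier →ₗ[F[X]] carrier
  d_d : ∀ k, d (d k) = 0
  gr : ℤ × ℤ → Submodule F carrier
  gr_isInternal : DirectSum.IsInternal gr
  X_smul_mem : ∀ n p, ∀ k ∈ gr (n, p), (X : F[X]) • k ∈ gr (n, p + 1)
  d_mem : ∀ n p, ∀ k ∈ gr (n, p), d k ∈ gr (n - 1, p)
  regular : IsSMulRegular carrier (X : F[X])

namespace GradedComplex

attribute [instance] acg modX mod tower

variable {F : Type u} [Field F] (K : GradedComplex.{u, v} F)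

/-- The homology `H(K)`, an `F[x]`-module. -/
abbrev H : Type v := DHomology K.d

/-- The bigrading of `H(K)`. -/
noncomputable def grH : ℤ × ℤ → Submodule F K.H := DHomology.gr K.d K.gr

/-- The differential of `K / xK`. -/
noncomputable def dQ : QuotSMulTop (X : F[X]) K.carrier →ₗ[F[X]] QuotSMulTop (X : F[X]) K.carrier :=
  QuotSMulTop.map X K.d

/-- The quotient map `π_x : K → K / xK`. -/
noncomputable def toQ : K.carrier →ₗ[F[X]] QuotSMulTop (X : F[X]) K.carrier := Submodule.mkQ _

theorem toQ_surjective : Function.Surjective K.toQ := Submodule.mkQ_surjective _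

theorem toQ_eq_zero (k : K.carrier) : K.toQ k = 0 ↔ ∃ k', (X : F[X]) • k' = k := by
  simp [toQ, Submodule.mem_smul_pointwise_iff_exists]

theorem toQ_d (k : K.carrier) : K.toQ (K.d k) = K.dQ (K.toQ k) := rfl

/-- The bigrading of `K / xK`. -/
noncomputable def grQ (i : ℤ × ℤ) : Submodule F (QuotSMulTop (X : F[X]) K.carrier) :=
  (K.gr i).map (K.toQ.restrictScalars F)

theorem d_mem' (i : ℤ × ℤ) (k : K.carrier) (hk : k ∈ K.gr i) : K.d k ∈ K.gr (i + (-1, 0)) := by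
  obtain ⟨n, p⟩ := i
  have := K.d_mem n p k hk
  rwa [show ((n - 1, p) : ℤ × ℤ) = (n, p) + (-1, 0) by simp [sub_eq_add_neg]] at this

theorem X_smul_mem' (i : ℤ × ℤ) (k : K.carrier) (hk : k ∈ K.gr i) :
    (X : F[X]) • k ∈ K.gr (i + (0, 1)) := by
  obtain ⟨n, p⟩ := i
  have := K.X_smul_mem n p k hk
  rwa [show ((n, p + 1) : ℤ × ℤ) = (n, p) + (0, 1) by simp] at this

theorem proj_d (i : ℤ × ℤ) (k : K.carrier) :
    proj K.gr_isInternal (i + (-1, 0)) (K.d k) = K.d (proj K.gr_isInternal i k) :=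
  proj_map K.gr_isInternal K.gr_isInternal (K.d.restrictScalars F) _ K.d_mem' i k

theorem proj_X (i : ℤ × ℤ) (k : K.carrier) :
    proj K.gr_isInternal (i + (0, 1)) ((X : F[X]) • k) =
      (X : F[X]) • proj K.gr_isInternal i k :=
  proj_map K.gr_isInternal K.gr_isInternal ((LinearMap.lsmul F[X] K.carrier X).restrictScalars F) _ K.X_smul_mem' i k

theorem grQ_isInternal : DirectSum.IsInternal K.grQ := by
  refine isInternal_map K.gr_isInternal (K.toQ.restrictScalars F) K.toQ_surjective ?_
  intro i v hv
  obtain ⟨k, rfl⟩ := (K.toQ_eq_zero v).1 hv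
  refine (K.toQ_eq_zero _).2 ⟨proj K.gr_isInternal (i - (0, 1)) k, ?_⟩
  rw [← K.proj_X, sub_add_cancel]

theorem dQ_mem (i : ℤ × ℤ) (y : QuotSMulTop (X : F[X]) K.carrier) (hy : y ∈ K.grQ i) :
    K.dQ y ∈ K.grQ (i + (-1, 0)) := by
  obtain ⟨k, hk, rfl⟩ := hy
  exact ⟨K.d k, K.d_mem' i k hk, rfl⟩

/-- The homology `H(K / xK)`. -/
abbrev HQ : Type v := DHomology K.dQ

/-- Multiplication by `x` on `H(K)`. -/
noncomputable def fH : K.H →ₗ[F] K.H := (LinearMap.lsmul F[X] K.H X).restrictScalars F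

/-- The map `(π_x)_* : H(K) → H(K / xK)`. -/
noncomputable def gH : K.H →ₗ[F] K.HQ := (DHomology.map K.toQ K.toQ_d).restrictScalars F

/-- The relation `[π_x k] ↦ [k']` whenever `d k = x k'`, defining the connecting map. -/
noncomputable def relH : Submodule F (K.HQ × K.H) where
  carrier := {q | ∃ (k : K.carrier) (y : LinearMap.ker K.dQ) (k' : LinearMap.ker K.d),
    (y : QuotSMulTop (X : F[X]) K.carrier) = K.toQ k ∧ K.d k = (X : F[X]) • (k' : K.carrier) ∧
      q.1 = DHomology.mk K.dQ y ∧ q.2 = DHomology.mk K.d k'}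
  zero_mem' := ⟨0, 0, 0, by simp, by simp, by simp, by simp⟩
  add_mem' := by
    rintro _ _ ⟨k, y, k', h1, h2, h3, h4⟩ ⟨l, z, l', g1, g2, g3, g4⟩
    exact ⟨k + l, y + z, k' + l', by simp [h1, g1], by simp [h2, g2], by simp [h3, g3],
      by simp [h4, g4]⟩
  smul_mem' := by
    rintro t _ ⟨k, y, k', h1, h2, h3, h4⟩
    refine ⟨t • k, t • y, t • k', ?_, ?_, ?_, ?_⟩
    · rw [Submodule.coe_smul_of_tower, h1]
      exact ((K.toQ.restrictScalars F).map_smul t k).symm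
    · rw [Submodule.coe_smul_of_tower, smul_comm, ← h2]
      exact (K.d.restrictScalars F).map_smul t k
    · rw [Prod.smul_fst, h3]
      exact (((DHomology.mk K.dQ).restrictScalars F).map_smul t y).symm
    · rw [Prod.smul_snd, h4]
      exact (((DHomology.mk K.d).restrictScalars F).map_smul t k').symm

theorem relH_total (y : K.HQ) : ∃ w, (y, w) ∈ K.relH := by
  obtain ⟨⟨y, hy⟩, rfl⟩ := DHomology.mk_surjective K.dQ y
  obtain ⟨k, rfl⟩ := K.toQ_surjective y
  rw [LinearMap.mem_ker, ← toQ_d] at hy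
  obtain ⟨k', hk'⟩ := (K.toQ_eq_zero _).1 hy
  have hd : k' ∈ LinearMap.ker K.d := by
    rw [LinearMap.mem_ker]
    apply K.regular
    change (X : F[X]) • K.d k' = (X : F[X]) • (0 : K.carrier)
    rw [← map_smul, hk', K.d_d, smul_zero]
  exact ⟨_, k, _, ⟨k', hd⟩, rfl, hk'.symm, rfl, rfl⟩

theorem relH_fun (w : K.H) (hw : (0, w) ∈ K.relH) : w = 0 := by
  obtain ⟨k, y, k', h1, h2, h3, rfl⟩ := hw
  obtain ⟨z, hz⟩ := (DHomology.mk_eq_zero K.dQ y).1 h3.symm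
  obtain ⟨l, rfl⟩ := K.toQ_surjective z
  have : K.toQ (k - K.d l) = 0 := by rw [map_sub, toQ_d, hz, h1, sub_self]
  obtain ⟨b, hb⟩ := (K.toQ_eq_zero _).1 this
  refine (DHomology.mk_eq_zero K.d k').2 ⟨b, K.regular ?_⟩
  change (X : F[X]) • K.d b = (X : F[X]) • (k' : K.carrier)
  rw [← map_smul, hb, map_sub, K.d_d, sub_zero, h2]

/-- The connecting map `Δ : H(K / xK) → H(K)` of `0 → K{1} → K → K / xK → 0`. -/
noncomputable def hH : K.HQ →ₗ[F] K.H := linOfRel K.relH K.relH_total K.relH_fun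

theorem hH_apply (k : K.carrier) (y : LinearMap.ker K.dQ) (k' : LinearMap.ker K.d)
    (h1 : (y : QuotSMulTop (X : F[X]) K.carrier) = K.toQ k)
    (h2 : K.d k = (X : F[X]) • (k' : K.carrier)) :
    K.hH (DHomology.mk K.dQ y) = DHomology.mk K.d k' :=
  linOfRel_eq _ _ _ ⟨k, y, k', h1, h2, rfl, rfl⟩

theorem exists_lift (y : LinearMap.ker K.dQ) : ∃ (k : K.carrier) (k' : LinearMap.ker K.d),
    (y : QuotSMulTop (X : F[X]) K.carrier) = K.toQ k ∧ K.d k = (X : F[X]) • (k' : K.carrier) := by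
  obtain ⟨w, k, y', k', h1, h2, h3, -⟩ := K.relH_total (DHomology.mk K.dQ y)
  have h3' : DHomology.mk K.dQ (y - y') = 0 := by rw [map_sub, sub_eq_zero]; exact h3
  obtain ⟨z, hz⟩ := (DHomology.mk_eq_zero K.dQ _).1 h3'
  obtain ⟨l, rfl⟩ := K.toQ_surjective z
  refine ⟨k + K.d l, k', ?_, by rw [map_add, K.d_d, add_zero, h2]⟩
  rw [map_add, toQ_d, hz, ← h1]
  simp

/-- The exact couple of `K`, induced by `0 → K{1} → K → K / xK → 0`. -/
noncomputable def couple : ExactCouple.{u, v} F where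
  A := K.H
  E := K.HQ
  f := K.fH
  g := K.gH
  h := K.hH
  exact_fg := by
    intro a
    obtain ⟨z, rfl⟩ := DHomology.mk_surjective K.d a
    have hq : K.toQ z ∈ LinearMap.ker K.dQ := by
      rw [LinearMap.mem_ker, ← toQ_d, LinearMap.mem_ker.1 z.2, map_zero]
    have hg : K.gH (DHomology.mk K.d z) = DHomology.mk K.dQ ⟨K.toQ z, hq⟩ :=
      DHomology.map_mk K.toQ K.toQ_d z ⟨K.toQ z, hq⟩ rfl
    rw [hg, DHomology.mk_eq_zero]
    constructor
    · rintro ⟨y, hy⟩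
      obtain ⟨l, rfl⟩ := K.toQ_surjective y
      have : K.toQ (z - K.d l) = 0 := by rw [map_sub, toQ_d, hy, sub_self]
      obtain ⟨b, hb⟩ := (K.toQ_eq_zero _).1 this
      have hbk : b ∈ LinearMap.ker K.d := by
        rw [LinearMap.mem_ker]
        apply K.regular
        change (X : F[X]) • K.d b = (X : F[X]) • (0 : K.carrier)
        rw [← map_smul, hb, map_sub, K.d_d, LinearMap.mem_ker.1 z.2, sub_zero, smul_zero]
      refine ⟨DHomology.mk K.d ⟨b, hbk⟩, ?_⟩
      change (X : F[X]) • DHomology.mk K.d ⟨b, hbk⟩ = _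
      rw [← map_smul, ← sub_eq_zero, ← map_sub, DHomology.mk_eq_zero]
      refine ⟨-l, ?_⟩
      rw [map_neg, Submodule.coe_sub, Submodule.coe_smul, hb]
      abel
    · rintro ⟨a, ha⟩
      obtain ⟨b, rfl⟩ := DHomology.mk_surjective K.d a
      change (X : F[X]) • DHomology.mk K.d b = _ at ha
      rw [← map_smul, ← sub_eq_zero, ← map_sub, DHomology.mk_eq_zero] at ha
      obtain ⟨l, hl⟩ := ha
      refine ⟨K.toQ (-l), ?_⟩
      rw [← toQ_d, map_neg, hl, Submodule.coe_sub, Submodule.coe_smul, neg_sub, map_sub,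
        (K.toQ_eq_zero ((X : F[X]) • (b : K.carrier))).2 ⟨_, rfl⟩, sub_zero]
  exact_gh := by
    intro e
    obtain ⟨y, rfl⟩ := DHomology.mk_surjective K.dQ e
    constructor
    · intro he
      obtain ⟨k, k', h1, h2⟩ := K.exists_lift y
      rw [K.hH_apply k y k' h1 h2] at he
      obtain ⟨l, hl⟩ := (DHomology.mk_eq_zero K.d k').1 he
      have hz : k - (X : F[X]) • l ∈ LinearMap.ker K.d := by
        rw [LinearMap.mem_ker, map_sub, map_smul, hl, h2, sub_self]
      refine ⟨DHomology.mk K.d ⟨_, hz⟩, ?_⟩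
      refine DHomology.map_mk K.toQ K.toQ_d ⟨_, hz⟩ y ?_
      rw [h1, map_sub, (K.toQ_eq_zero ((X : F[X]) • l)).2 ⟨_, rfl⟩, sub_zero]
    · rintro ⟨a, ha⟩
      obtain ⟨z, rfl⟩ := DHomology.mk_surjective K.d a
      have hq : K.toQ z ∈ LinearMap.ker K.dQ := by
        rw [LinearMap.mem_ker, ← toQ_d, LinearMap.mem_ker.1 z.2, map_zero]
      have hg : K.gH (DHomology.mk K.d z) = DHomology.mk K.dQ ⟨K.toQ z, hq⟩ :=
        DHomology.map_mk K.toQ K.toQ_d z ⟨K.toQ z, hq⟩ rfl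
      rw [← ha, hg, K.hH_apply z _ 0 rfl (by simp), map_zero]
  exact_hf := by
    intro a
    obtain ⟨z, rfl⟩ := DHomology.mk_surjective K.d a
    change (X : F[X]) • DHomology.mk K.d z = 0 ↔ _
    rw [← map_smul, DHomology.mk_eq_zero]
    constructor
    · rintro ⟨k, hk⟩
      have hy : K.toQ k ∈ LinearMap.ker K.dQ := by
        rw [LinearMap.mem_ker, ← toQ_d, hk]
        exact (K.toQ_eq_zero _).2 ⟨_, rfl⟩
      exact ⟨DHomology.mk K.dQ ⟨K.toQ k, hy⟩, K.hH_apply k _ z rfl hk⟩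
    · rintro ⟨e, he⟩
      obtain ⟨y, rfl⟩ := DHomology.mk_surjective K.dQ e
      obtain ⟨k, k', h1, h2⟩ := K.exists_lift y
      rw [K.hH_apply k y k' h1 h2, ← sub_eq_zero, ← map_sub, DHomology.mk_eq_zero] at he
      obtain ⟨l, hl⟩ := he
      refine ⟨k - (X : F[X]) • l, ?_⟩
      rw [map_sub, map_smul, hl, h2, Submodule.coe_sub, smul_sub, Submodule.coe_smul]
      abel
  grA := K.grH
  grE := DHomology.gr K.dQ K.grQ
  grA_isInternal := DHomology.gr_isInternal K.d K.gr_isInternal _ K.d_mem'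
  grE_isInternal := DHomology.gr_isInternal K.dQ K.grQ_isInternal _ K.dQ_mem
  degF := (0, 1)
  degG := (0, 0)
  degH := (-1, -1)
  f_mem := by
    rintro i _ ⟨z, hz, rfl⟩
    exact ⟨(X : F[X]) • z, K.X_smul_mem' i z hz, rfl⟩
  g_mem := by
    rintro i _ ⟨z, hz, rfl⟩
    rw [show ((0, 0) : ℤ × ℤ) = 0 from rfl, add_zero]
    have hq : K.toQ z ∈ LinearMap.ker K.dQ := by
      rw [LinearMap.mem_ker, ← toQ_d, LinearMap.mem_ker.1 z.2, map_zero]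
    exact ⟨⟨K.toQ z, hq⟩, ⟨z, hz, rfl⟩, (DHomology.map_mk K.toQ K.toQ_d z ⟨K.toQ z, hq⟩ rfl).symm⟩
  h_mem := by
    rintro i _ ⟨y, ⟨k, hk, hky⟩, rfl⟩
    have hy : K.toQ (K.d k) = 0 := by
      rw [toQ_d]
      exact (congrArg K.dQ hky).trans y.2
    obtain ⟨k', hk'⟩ := (K.toQ_eq_zero _).1 hy
    have hd : k' ∈ LinearMap.ker K.d := by
      rw [LinearMap.mem_ker]
      apply K.regular
      change (X : F[X]) • K.d k' = (X : F[X]) • (0 : K.carrier)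
      rw [← map_smul, hk', K.d_d, smul_zero]
    have h1 := K.hH_apply k y ⟨k', hd⟩ hky.symm hk'.symm
    refine ⟨⟨k', hd⟩, ?_, h1.symm⟩
    have h2 : (X : F[X]) • proj K.gr_isInternal (i + (-1, -1)) k' = (X : F[X]) • k' := by
      rw [← K.proj_X, hk', show i + (-1, -1) + (0, 1) = i + (-1, 0) by simp [add_assoc],
        proj_of_mem _ (K.d_mem' i k hk), if_pos rfl]
    have h3 := K.regular h2
    change k' ∈ K.gr _
    rw [← h3]
    exact proj_mem _ _ _

/-- The exact couple `𝓗^(k+1)(K)`; its `E`-term is the page `E^(k+1)(K)` of the spectral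
sequence of `K`. -/
noncomputable def coupleAt (k : ℕ) : ExactCouple.{u, v} F := K.couple.iter k

/-- The page `E^(k+1)(K)`. -/
noncomputable abbrev page (k : ℕ) : Type v := (K.coupleAt k).E

/-- The bigrading of the page `E^(k+1)(K)`. -/
noncomputable abbrev grPage (k : ℕ) : ℤ × ℤ → Submodule F (K.page k) := (K.coupleAt k).grE

/-- The differential of the page `E^(k+1)(K)`. -/
noncomputable abbrev dPage (k : ℕ) : K.page k →ₗ[F] K.page k := (K.coupleAt k).d

/-- The class in the next page of a cycle in the page `E^(k+1)(K)`. -/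
noncomputable def nextPage (k : ℕ) : LinearMap.ker (K.dPage k) →ₗ[F] K.page (k + 1) :=
  (K.coupleAt k).toDerived

/-- The limit page `E^(∞)(K)`. -/
noncomputable abbrev pageInf : Type v := K.couple.Einf

/-- The bigrading of `E^(∞)(K)`. -/
noncomputable abbrev grPageInf : ℤ × ℤ → Submodule F K.pageInf := K.couple.grEinf

/-- The class in `E^(∞)(K)` of a permanent cycle in the first page. -/
noncomputable def toPageInf : K.couple.Zinf →ₗ[F] K.pageInf := Submodule.mkQ _

/-- The complex given by an `F`-space with a differential `δ` and the action `σ` of `x`. -/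
noncomputable def ofEnd {V : Type v} [AddCommGroup V] [Module F V] (σ δ : V →ₗ[F] V)
    (hδ : ∀ v, δ (δ v) = 0) (hc : ∀ v, δ (σ v) = σ (δ v)) (hσ : Function.Injective σ)
    (G : ℤ × ℤ → Submodule F V) (hG : DirectSum.IsInternal G)
    (hGσ : ∀ n p, ∀ v ∈ G (n, p), σ v ∈ G (n, p + 1))
    (hGδ : ∀ n p, ∀ v ∈ G (n, p), δ v ∈ G (n - 1, p)) : GradedComplex.{u, v} F where
  carrier := Module.AEval' σ
  d := LinearMap.ofAEval σ ((Module.AEval'.of σ).toLinearMap ∘ₗ δ) fun v =>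
    (congrArg (Module.AEval'.of σ) (hc v)).trans (Module.AEval'.X_smul_of σ (δ v)).symm
  d_d := fun k => (congrArg (Module.AEval'.of σ) (hδ ((Module.AEval'.of σ).symm k))).trans
    (map_zero _)
  gr := fun i => (G i).map (Module.AEval'.of σ).toLinearMap
  gr_isInternal := isInternal_map hG (Module.AEval'.of σ).toLinearMap
    (Module.AEval'.of σ).surjective fun i v hv => by
      have h0 : v = 0 := (Module.AEval'.of σ).map_eq_zero_iff.1 hv
      rw [h0, map_zero, map_zero]
  X_smul_mem := by
    rintro n p _ ⟨v, hv, rfl⟩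
    exact ⟨σ v, hGσ n p v hv, (Module.AEval'.X_smul_of σ v).symm⟩
  d_mem := by
    rintro n p _ ⟨v, hv, rfl⟩
    exact ⟨δ v, hGδ n p v hv, rfl⟩
  regular := by
    intro a b hab
    obtain ⟨v, rfl⟩ := (Module.AEval'.of σ).surjective a
    obtain ⟨w, rfl⟩ := (Module.AEval'.of σ).surjective b
    have hab' : (X : F[X]) • Module.AEval'.of σ v = (X : F[X]) • Module.AEval'.of σ w := hab
    rw [Module.AEval'.X_smul_of, Module.AEval'.X_smul_of] at hab'
    rw [hσ ((Module.AEval'.of σ).injective hab')]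

end GradedComplex

/-! ### The elementary complexes `U_{n,s,m}` -/

section Elementary

variable {F : Type u} [Field F]

/-- The bigrading of `F[x]‖n‖{s}`: `x ^ k` lies in bidegree `(n, k + s)`. -/
def polyGr (F : Type u) [Field F] (n s : ℤ) (i : ℤ × ℤ) : Submodule F F[X] where
  carrier := {q | ∀ k : ℕ, q.coeff k ≠ 0 → i = (n, (k : ℤ) + s)}
  zero_mem' := by simp
  add_mem' := by
    intro a b ha hb k hk
    by_contra hc
    refine hk ?_
    rw [coeff_add, by_contra fun h => hc (ha k h), by_contra fun h => hc (hb k h), add_zero]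
  smul_mem' := by
    intro t a ha k hk
    refine ha k fun h => hk ?_
    rw [coeff_smul, h, smul_zero]

theorem mem_polyGr {n s : ℤ} {i : ℤ × ℤ} {q : F[X]} :
    q ∈ polyGr F n s i ↔ ∀ k : ℕ, q.coeff k ≠ 0 → i = (n, (k : ℤ) + s) := Iff.rfl

theorem polyGr_isInternal (n s : ℤ) : DirectSum.IsInternal (polyGr F n s) := by
  classical
  refine isInternal_of_proj (fun i => if i.1 = n ∧ s ≤ i.2 then
    (monomial (i.2 - s).toNat) ∘ₗ lcoeff F (i.2 - s).toNat else 0) ?_ ?_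
  · rintro i ⟨n', p⟩ q hq
    by_cases hj : n' = n ∧ s ≤ p
    · rw [if_pos hj]
      obtain ⟨rfl, hp⟩ := hj
      obtain ⟨k, hk⟩ : ∃ k : ℕ, p = k + s := ⟨(p - s).toNat, by omega⟩
      have : (p - s).toNat = k := by omega
      ext l
      simp only [this, LinearMap.comp_apply, lcoeff_apply, coeff_monomial]
      by_cases hi : i = (n', p)
      · rw [if_pos hi]
        split_ifs with h
        · rw [h]
        · by_contra hc
          have := hq l (Ne.symm hc)
          rw [hi] at this
          simp only [Prod.mk.injEq, true_and] at this
          omega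
      · rw [if_neg hi, coeff_zero]
        split_ifs with h
        · by_contra hc
          apply hi
          rw [hq k hc, hk]
        · rfl
    · rw [if_neg hj]
      split_ifs with hi
      · ext l
        by_contra hc
        have := hq l (by simpa using Ne.symm hc)
        rw [hi] at this
        simp only [Prod.mk.injEq] at this
        exact hj ⟨this.1, by omega⟩
      · rfl
  · rw [eq_top_iff]
    intro q _
    rw [q.as_sum_support]
    refine Submodule.sum_mem _ fun k _ => ?_
    refine Submodule.mem_iSup_of_mem (n, (k : ℤ) + s) ?_
    intro l hl
    rw [coeff_monomial] at hl
    split_ifs at hl with h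
    · rw [h]
    · exact absurd rfl hl

theorem X_smul_mem_polyGr {n s n' p : ℤ} {q : F[X]} (hq : q ∈ polyGr F n s (n', p)) :
    (X : F[X]) • q ∈ polyGr F n s (n', p + 1) := by
  intro k hk
  rw [smul_eq_mul] at hk
  cases k with
  | zero => simp at hk
  | succ k =>
    rw [coeff_X_mul] at hk
    have := hq k hk
    simp only [Prod.mk.injEq] at this ⊢
    push_cast
    omega

theorem prodGr_isInternal {V : Type v} [AddCommGroup V] [Module F V]
    {W : Type w} [AddCommGroup W] [Module F W] {G : ℤ × ℤ → Submodule F V}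
    (hG : DirectSum.IsInternal G) {H : ℤ × ℤ → Submodule F W} (hH : DirectSum.IsInternal H) :
    DirectSum.IsInternal (fun i => (G i).prod (H i)) := by
  refine isInternal_of_proj (fun i => (proj hG i).prodMap (proj hH i)) ?_ ?_
  · rintro i j ⟨a, b⟩ ⟨ha, hb⟩
    rw [LinearMap.prodMap_apply, proj_of_mem hG ha, proj_of_mem hH hb]
    split_ifs <;> rfl
  · rw [eq_top_iff]
    rintro ⟨a, b⟩ _
    have h1 : ((a, 0) : V × W) ∈ ⨆ i, (G i).prod (H i) :=
      homogeneous_induction hG (P := fun a => ((a, 0) : V × W) ∈ ⨆ i, (G i).prod (H i)) a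
        (fun i v hv => Submodule.mem_iSup_of_mem i ⟨hv, Submodule.zero_mem _⟩)
        (Submodule.zero_mem _)
        (fun v w hv hw => by simpa using Submodule.add_mem _ hv hw)
    have h2 : ((0, b) : V × W) ∈ ⨆ i, (G i).prod (H i) :=
      homogeneous_induction hH (P := fun b => ((0, b) : V × W) ∈ ⨆ i, (G i).prod (H i)) b
        (fun i v hv => Submodule.mem_iSup_of_mem i ⟨Submodule.zero_mem _, hv⟩)
        (Submodule.zero_mem _)
        (fun v w hv hw => by simpa using Submodule.add_mem _ hv hw)
    simpa using Submodule.add_mem _ h1 h2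

/-- The complex `0 → F[x]‖n‖{s} → 0`. -/
noncomputable abbrev Ufree (F : Type u) [Field F] (n s : ℤ) : GradedComplex.{u, u} F where
  carrier := F[X]
  d := 0
  d_d := fun _ => rfl
  gr := polyGr F n s
  gr_isInternal := polyGr_isInternal n s
  X_smul_mem := fun _ _ _ hk => X_smul_mem_polyGr hk
  d_mem := fun _ _ _ _ => Submodule.zero_mem _
  regular := fun _ _ hab => mul_left_cancel₀ X_ne_zero hab

/-- The complex `0 → F[x]‖n+1‖{s+m} → F[x]‖n‖{s} → 0` with differential `x ^ m`. -/
noncomputable abbrev Utors (F : Type u) [Field F] (n s : ℤ) (m : ℕ) : GradedComplex.{u, u} F where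
  carrier := F[X] × F[X]
  d := LinearMap.inr F[X] F[X] F[X] ∘ₗ LinearMap.lsmul F[X] F[X] (X ^ m) ∘ₗ
    LinearMap.fst F[X] F[X] F[X]
  d_d := fun k => by simp
  gr := fun i => (polyGr F (n + 1) (s + m) i).prod (polyGr F n s i)
  gr_isInternal := prodGr_isInternal (polyGr_isInternal _ _) (polyGr_isInternal _ _)
  X_smul_mem := fun _ _ _ hk => ⟨X_smul_mem_polyGr hk.1, X_smul_mem_polyGr hk.2⟩
  d_mem := by
    rintro n' p ⟨a, b⟩ ⟨ha, -⟩
    refine ⟨Submodule.zero_mem _, ?_⟩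
    intro k hk
    change (X ^ m * a).coeff k ≠ 0 at hk
    rw [coeff_X_pow_mul'] at hk
    split_ifs at hk with h
    · have := ha _ hk
      simp only [Prod.mk.injEq] at this ⊢
      omega
    · exact absurd rfl hk
  regular := fun _ _ hab => Prod.ext (mul_left_cancel₀ X_ne_zero (congrArg Prod.fst hab))
    (mul_left_cancel₀ X_ne_zero (congrArg Prod.snd hab))

/-- The complex `U_{n,s,m}`, where `m` is a positive integer or `∞`. -/
noncomputable def U (F : Type u) [Field F] (n s : ℤ) : WithTop ℕ+ → GradedComplex.{u, u} F
  | ⊤ => Ufree F n s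
  | (m : ℕ+) => Utors F n s m

end Elementary

/-! ### Filtered complexes and their persistent chain complexes -/

/-- A filtered chain complex over `F`: a chain complex with an ascending `ℤ`-filtration by
subcomplexes, `fil p n` being the `p`-th stage in homological degree `n`. -/
structure FilteredComplex (F : Type u) [Field F] : Type (max u (v + 1)) where
  C : ChainComplex (ModuleCat.{v} F) ℤ
  fil : ℤ → ∀ n : ℤ, Submodule F (C.X n)
  mono : ∀ p q n, p ≤ q → fil p n ≤ fil q n
  d_mem : ∀ p n, ∀ c ∈ fil p n, (C.d n (n - 1)).hom c ∈ fil p (n - 1)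

namespace FilteredComplex

variable {F : Type u} [Field F] (C : FilteredComplex.{u, v} F)

/-- The filtration is bounded below in each homological degree. -/
def BoundedBelow : Prop := ∀ n, ∃ p, C.fil p n = ⊥

/-- Each stage of the filtration is finite dimensional in each homological degree. -/
def LocallyFinite : Prop := ∀ p n, FiniteDimensional F (C.fil p n)

/-- The sum of all filtration stages, indexed by `(n, p)`. -/
abbrev Total : Type v := DirectSum (ℤ × ℤ) fun i => C.fil i.2 i.1

/-- The inclusion of the stage `fil p n` into the total space. -/
noncomputable def inj (n p : ℤ) : C.fil p n →ₗ[F] C.Total :=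
  DirectSum.lof F (ℤ × ℤ) (fun i => C.fil i.2 i.1) (n, p)

/-- The projection of the total space to the stage `fil p n`. -/
noncomputable def comp (n p : ℤ) : C.Total →ₗ[F] C.fil p n :=
  DirectSum.component F (ℤ × ℤ) (fun i => C.fil i.2 i.1) (n, p)

theorem comp_inj (n p : ℤ) (c : C.fil p n) : C.comp n p (C.inj n p c) = c :=
  DirectSum.component.lof_self (R := F) (M := fun i : ℤ × ℤ => C.fil i.2 i.1) (n, p) c

theorem comp_inj_ne {n p n' p' : ℤ} (c : C.fil p n) (h : ¬ (n = n' ∧ p = p')) :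
    C.comp n' p' (C.inj n p c) = 0 := by
  refine (DirectSum.component.of (R := F) (M := fun i : ℤ × ℤ => C.fil i.2 i.1) (n', p') (n, p) c).trans ?_
  rw [dif_neg]
  rwa [Prod.mk.injEq]

theorem total_ext {W : Type*} [AddCommGroup W] [Module F W] {S T : C.Total →ₗ[F] W}
    (h : ∀ n p (c : C.fil p n), S (C.inj n p c) = T (C.inj n p c)) (v : C.Total) : S v = T v := by
  refine LinearMap.congr_fun (DirectSum.linearMap_ext F fun i => LinearMap.ext fun c => ?_) v
  exact h i.1 i.2 c

/-- The action of `x`: the inclusions of the `p`-th stages into the `(p + 1)`-st ones. -/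
noncomputable def shift : C.Total →ₗ[F] C.Total :=
  DirectSum.toModule F (ℤ × ℤ) C.Total fun i =>
    C.inj i.1 (i.2 + 1) ∘ₗ Submodule.inclusion (C.mono i.2 (i.2 + 1) i.1 (by omega))

/-- The differential, as a map of `F`-spaces. -/
noncomputable def dTotal : C.Total →ₗ[F] C.Total :=
  DirectSum.toModule F (ℤ × ℤ) C.Total fun i =>
    C.inj (i.1 - 1) i.2 ∘ₗ (C.C.d i.1 (i.1 - 1)).hom.restrict (C.d_mem i.2 i.1)

theorem shift_inj (n p : ℤ) (c : C.fil p n) :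
    C.shift (C.inj n p c) =
      C.inj n (p + 1) (Submodule.inclusion (C.mono p (p + 1) n (by omega)) c) :=
  DirectSum.toModule_lof (M := fun i : ℤ × ℤ => C.fil i.2 i.1) F (n, p) c

theorem dTotal_inj (n p : ℤ) (c : C.fil p n) :
    C.dTotal (C.inj n p c) =
      C.inj (n - 1) p ((C.C.d n (n - 1)).hom.restrict (C.d_mem p n) c) :=
  DirectSum.toModule_lof (M := fun i : ℤ × ℤ => C.fil i.2 i.1) F (n, p) c

theorem dTotal_dTotal (v : C.Total) : C.dTotal (C.dTotal v) = 0 := by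
  refine C.total_ext (S := C.dTotal ∘ₗ C.dTotal) (T := 0) (fun n p c => ?_) v
  rw [LinearMap.comp_apply, dTotal_inj, dTotal_inj]
  refine (congrArg _ (Subtype.ext ?_)).trans (map_zero (C.inj (n - 1 - 1) p))
  change (C.C.d (n - 1) (n - 1 - 1)).hom ((C.C.d n (n - 1)).hom c) = 0
  rw [← ModuleCat.comp_apply, C.C.d_comp_d]
  rfl

theorem dTotal_shift (v : C.Total) : C.dTotal (C.shift v) = C.shift (C.dTotal v) := by
  refine C.total_ext (S := C.dTotal ∘ₗ C.shift) (T := C.shift ∘ₗ C.dTotal) (fun n p c => ?_) v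
  rw [LinearMap.comp_apply, LinearMap.comp_apply, dTotal_inj, shift_inj, dTotal_inj, shift_inj]
  rfl

theorem shift_apply (v : C.Total) (n p : ℤ) :
    (C.comp n (p + 1) (C.shift v) : C.C.X n) = C.comp n p v := by
  refine C.total_ext (S := (C.fil (p + 1) n).subtype ∘ₗ C.comp n (p + 1) ∘ₗ C.shift)
    (T := (C.fil p n).subtype ∘ₗ C.comp n p) (fun n' p' c => ?_) v
  rw [LinearMap.comp_apply, LinearMap.comp_apply, LinearMap.comp_apply, shift_inj]
  by_cases h : n' = n ∧ p' = p
  · obtain ⟨rfl, rfl⟩ := h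
    rw [comp_inj, comp_inj]
    rfl
  · rw [comp_inj_ne _ _ h, comp_inj_ne _ _ (by omega), map_zero, map_zero]

theorem shift_injective : Function.Injective C.shift := by
  intro v w h
  refine DFinsupp.ext fun i => Subtype.ext ?_
  have h1 := C.shift_apply v i.1 i.2
  rw [h, C.shift_apply w i.1 i.2] at h1
  exact h1.symm

/-- The component of the total space in bidegree `i = (n, p)`. -/
noncomputable def grTotal (i : ℤ × ℤ) : Submodule F C.Total := LinearMap.range (C.inj i.1 i.2)

theorem grTotal_isInternal : DirectSum.IsInternal C.grTotal := by
  refine isInternal_of_proj (fun i => C.inj i.1 i.2 ∘ₗ C.comp i.1 i.2) ?_ ?_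
  · rintro ⟨n, p⟩ ⟨n', p'⟩ _ ⟨c, rfl⟩
    rw [LinearMap.comp_apply]
    by_cases h : n = n' ∧ p = p'
    · obtain ⟨rfl, rfl⟩ := h
      rw [comp_inj, if_pos rfl]
    · rw [comp_inj_ne _ _ h, map_zero, if_neg]
      rwa [Prod.mk.injEq]
  · rw [eq_top_iff]
    intro v _
    induction v using DirectSum.induction_on with
    | zero => exact Submodule.zero_mem _
    | of i c => exact Submodule.mem_iSup_of_mem i ⟨c, rfl⟩
    | add a b ha hb => exact Submodule.add_mem _ (ha trivial) (hb trivial)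

/-- The persistent chain complex: the direct sum over `p` of the subcomplexes `fil p`, with `x`
acting by the inclusions of the `p`-th stages into the `(p + 1)`-st ones. -/
noncomputable def PC : GradedComplex.{u, v} F :=
  GradedComplex.ofEnd C.shift C.dTotal C.dTotal_dTotal C.dTotal_shift C.shift_injective C.grTotal
    C.grTotal_isInternal
    (by
      rintro n p _ ⟨c, rfl⟩
      exact ⟨_, (C.shift_inj n p c).symm⟩)
    (by
      rintro n p _ ⟨c, rfl⟩
      exact ⟨_, (C.dTotal_inj n p c).symm⟩)

end FilteredComplex

/-! ### Decompositions -/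

/-- The numerical data of a decomposition: for each `n` a finite or infinite sequence of pairs
`(s_n(i), m_n(i))`, of length `K n` and indexed from `0`. -/
structure DecompData where
  K : ℤ → ℕ∞
  s : ∀ n, {i : ℕ // (i : ℕ∞) < K n} → ℤ
  m : ∀ n, {i : ℕ // (i : ℕ∞) < K n} → WithTop ℕ+
  finite : ∀ n t, {i | s n i = t}.Finite
  s_mono : ∀ n i j, i ≤ j → s n i ≤ s n j
  m_mono : ∀ n i j, i ≤ j → s n i = s n j → m n i ≤ m n j

/-- The set of all pairs `(n, i)` occurring in the data. -/
abbrev DecompData.Idx (D : DecompData) : Type := Σ n : ℤ, {i : ℕ // (i : ℕ∞) < D.K n}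

/-- The elementary complex `U_{n,s_n(i),m_n(i)}`. -/
noncomputable def DecompData.summand (D : DecompData) (F : Type u) [Field F] (a : D.Idx) :
    GradedComplex.{u, u} F :=
  U F a.1 (D.s a.1 a.2) (D.m a.1 a.2)

section Decomposition

variable {F : Type u} [Field F]

/-- An isomorphism of bigraded `F[x]`-modules `H(K) ≅ ⨁ H(L a)`. -/
structure HomologyDecomp {ι : Type*} (K : GradedComplex.{u, v} F) (L : ι → GradedComplex.{u, w} F) where
  iso : K.H ≃ₗ[F[X]] DirectSum ι fun a => (L a).H
  map_gr : ∀ i, (K.grH i).map (iso.toLinearMap.restrictScalars F) = sumGr (fun a => (L a).grH) i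

/-- An isomorphism between the spectral sequence of `K` and the direct sum of the spectral
sequences of the `L a`: bigraded isomorphisms of all pages, including the limit page, that commute
with the differentials and such that each is induced by the one on the preceding page
(respectively, for the limit page, by the one on the first page). -/
structure SpectralDecomp {ι : Type*} (K : GradedComplex.{u, v} F) (L : ι → GradedComplex.{u, w} F) where
  iso : ∀ k, K.page k ≃ₗ[F] DirectSum ι fun a => (L a).page k
  map_gr : ∀ k i, (K.grPage k i).map (iso k).toLinearMap = sumGr (fun a => (L a).grPage k) i
  map_d : ∀ k y a, iso k (K.dPage k y) a = (L a).dPage k (iso k y a)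
  map_next : ∀ k (y : LinearMap.ker (K.dPage k)) a (z : LinearMap.ker ((L a).dPage k)),
    (z : (L a).page k) = iso k y a → iso (k + 1) (K.nextPage k y) a = (L a).nextPage k z
  isoInf : K.pageInf ≃ₗ[F] DirectSum ι fun a => (L a).pageInf
  map_grInf : ∀ i, (K.grPageInf i).map isoInf.toLinearMap = sumGr (fun a => (L a).grPageInf) i
  map_inf : ∀ (y : K.couple.Zinf) a, ∃ z : (L a).couple.Zinf,
    (z.1 : (L a).page 0) = iso 0 (y.1 : K.page 0) a ∧ isoInf (K.toPageInf y) a = (L a).toPageInf z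

/-- The decomposition of the spectral sequence is induced by that of the homology: on the first
page, the two form an isomorphism of exact couples. -/
def SpectralDecomp.InducedBy {ι : Type*} {K : GradedComplex.{u, v} F}
    {L : ι → GradedComplex.{u, w} F} (Ψ : SpectralDecomp K L) (Φ : HomologyDecomp K L) : Prop :=
  (∀ (c : K.H) a, Ψ.iso 0 (K.gH c) a = (L a).gH (Φ.iso c a)) ∧
    ∀ (y : K.page 0) a, Φ.iso (K.hH y) a = (L a).hH (Ψ.iso 0 y a)

end Decomposition

end PHSS

open PHSS

/-!
# Decomposition of the spectral sequence of a filtered complex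

*Decomposing the homology.*  In each bidegree the persistent homology `M` is finite dimensional,
and it vanishes in low filtration degrees.  Filter the homogeneous components of `M / xM` by the
classes of the elements killed by `x ^ k`, choose bases adapted to these filtrations
(`exists_adapted_basis`), and lift each basis vector to an element of `M` that is killed by the
corresponding power of `x`.  The lifts generate `M` by induction on the degree.  They are
independent: write a homogeneous relation as `x ^ k • v = 0` with `v` in the highest degree of a
generator involved; the class of `v` in `M / xM` is the combination of the generators of that degree,
and by adaptedness it involves only generators that `x ^ k` kills, which do not occur in the relation
(`exists_iso_of_adapted`).  Finiteness in each degree allows the generators to be sorted into a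
sequence (`exists_sorted_enumeration`).

*From the homology to the spectral sequence.*  Over a field, the `E`-term of an exact couple is, up
to a choice of splittings, the sum of the cokernel and the kernel of `f : A → A`.  Hence an
isomorphism of the `A`-terms that commutes with `f` extends to a map of exact couples; its part of
degree `0` is still a map of exact couples, and the five lemma makes it bijective
(`exists_coupleDecomp`).  Deriving a couple commutes with direct sums, so the decomposition passes
to all pages (`CoupleDecomp.exists_derived`), and also to the limit page, because an element of a
direct sum has only finitely many nonzero components, whose vanishing is achieved on a common page
(`CoupleDecomp.mem_Binf`).

*The elementary complexes.*  Their first page is `K / xK`.  For reasons of bidegree all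
differentials vanish for `m = ∞`, and those before the page `E^(m)` vanish for `m < ∞`
(`ExactCouple.iter_d_eq_zero_of_support`).  For `m < ∞`, multiplication by `x ^ m` is zero on the
homology, so the `A`-term of the couple derived `m` times is zero, and with it the `E`-term
(`ExactCouple.subsingleton_iter_A`).
-/

namespace PHSS

/-! ### Graded maps and isomorphisms -/

section Grading

variable {F : Type u} [Field F] {V : Type v} [AddCommGroup V] [Module F V]
  {W : Type w} [AddCommGroup W] [Module F W]
  {G : ℤ × ℤ → Submodule F V} {H : ℤ × ℤ → Submodule F W}

theorem proj_ext (hG : DirectSum.IsInternal G) {v w : V}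
    (h : ∀ i, proj hG i v = proj hG i w) : v = w := by
  apply (compEquiv hG).symm.injective
  exact DFinsupp.ext fun i => Subtype.ext (h i)

theorem mem_iff_proj_eq (hG : DirectSum.IsInternal G) {i : ℤ × ℤ} {v : V} :
    v ∈ G i ↔ proj hG i v = v :=
  ⟨fun h => by rw [proj_of_mem hG h, if_pos rfl], fun h => h ▸ proj_mem hG i v⟩

theorem linearMap_ext_homogeneous (hG : DirectSum.IsInternal G) {S T : V →ₗ[F] W}
    (h : ∀ i, ∀ v ∈ G i, S v = T v) (v : V) : S v = T v :=
  homogeneous_induction hG (P := fun v => S v = T v) v h (by simp)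
    (fun v w hv hw => by simp [hv, hw])

/-- The part of degree `δ` of a linear map between graded spaces. -/
noncomputable def homogenize (hG : DirectSum.IsInternal G) (hH : DirectSum.IsInternal H)
    (δ : ℤ × ℤ) (T : V →ₗ[F] W) : V →ₗ[F] W :=
  (DirectSum.toModule F (ℤ × ℤ) W fun i => proj hH (i + δ) ∘ₗ T ∘ₗ (G i).subtype) ∘ₗ
    (compEquiv hG).symm.toLinearMap

theorem homogenize_of_mem (hG : DirectSum.IsInternal G) (hH : DirectSum.IsInternal H)
    (δ : ℤ × ℤ) (T : V →ₗ[F] W) {i : ℤ × ℤ} {v : V} (hv : v ∈ G i) :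
    homogenize hG hH δ T v = proj hH (i + δ) (T v) := by
  have : (compEquiv hG).symm v = DirectSum.lof F (ℤ × ℤ) (fun i => G i) i ⟨v, hv⟩ := by
    rw [LinearEquiv.symm_apply_eq]
    exact (DirectSum.coeLinearMap_lof G i ⟨v, hv⟩).symm
  simp only [homogenize, LinearMap.comp_apply, LinearEquiv.coe_coe, this]
  rw [DirectSum.toModule_lof]
  rfl

theorem homogenize_mem (hG : DirectSum.IsInternal G) (hH : DirectSum.IsInternal H)
    (δ : ℤ × ℤ) (T : V →ₗ[F] W) (i : ℤ × ℤ) (v : V) (hv : v ∈ G i) :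
    homogenize hG hH δ T v ∈ H (i + δ) := by
  rw [homogenize_of_mem hG hH δ T hv]
  exact proj_mem _ _ _

/-- A bijective homogeneous map of degree `0` identifies the homogeneous components. -/
theorem map_gr_eq_of_le (hG : DirectSum.IsInternal G) (hH : DirectSum.IsInternal H) (e : V ≃ₗ[F] W)
    (h : ∀ i, ∀ v ∈ G i, e v ∈ H i) (i : ℤ × ℤ) : (G i).map e.toLinearMap = H i := by
  apply le_antisymm
  · rintro _ ⟨v, hv, rfl⟩
    exact h i v hv
  · intro w hw
    refine ⟨proj hG i (e.symm w), proj_mem _ _ _, ?_⟩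
    have := proj_map hG hH e.toLinearMap 0 (fun i v hv => by simpa using h i v hv) i (e.symm w)
    rw [← this, add_zero]
    simpa using (mem_iff_proj_eq hH).1 hw

theorem map_gr_iff {e : V ≃ₗ[F] W} :
    (∀ i, (G i).map e.toLinearMap = H i) ↔ ∀ i v, e v ∈ H i ↔ v ∈ G i := by
  constructor
  · intro h i v
    rw [← h i, Submodule.mem_map]
    exact ⟨fun ⟨w, hw, hwv⟩ => e.injective hwv ▸ hw, fun hv => ⟨v, hv, rfl⟩⟩
  · intro h i
    ext w
    rw [Submodule.mem_map]
    exact ⟨fun ⟨v, hv, hvw⟩ => hvw ▸ (h i v).2 hv,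
      fun hw => ⟨e.symm w, (h i _).1 (by simpa using hw), by simp⟩⟩

theorem BigradedIso.of_iff (e : V ≃ₗ[F] W) (h : ∀ i v, e v ∈ H i ↔ v ∈ G i) : BigradedIso G H :=
  ⟨e, map_gr_iff.2 h⟩

theorem BigradedIso.refl (G : ℤ × ℤ → Submodule F V) : BigradedIso G G :=
  BigradedIso.of_iff (LinearEquiv.refl F V) fun _ _ => Iff.rfl

theorem BigradedIso.symm (h : BigradedIso G H) : BigradedIso H G := by
  obtain ⟨e, he⟩ := h
  rw [map_gr_iff] at he
  exact BigradedIso.of_iff e.symm fun i w => by rw [← he]; simp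

theorem BigradedIso.trans {W' : Type*} [AddCommGroup W'] [Module F W']
    {H' : ℤ × ℤ → Submodule F W'} (h : BigradedIso G H) (h' : BigradedIso H H') :
    BigradedIso G H' := by
  obtain ⟨e, he⟩ := h
  obtain ⟨e', he'⟩ := h'
  rw [map_gr_iff] at he he'
  exact BigradedIso.of_iff (e.trans e') fun i v => by
    rw [LinearEquiv.trans_apply, he', he]

theorem mem_sumGr {ι : Type*} {M : ι → Type*} [∀ a, AddCommGroup (M a)] [∀ a, Module F (M a)]
    {G : ∀ a, ℤ × ℤ → Submodule F (M a)} {i : ℤ × ℤ} {x : DirectSum ι M} :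
    x ∈ sumGr G i ↔ ∀ a, x a ∈ G a i := by
  rw [sumGr, Submodule.mem_iInf]
  rfl

theorem sumGr_isInternal {ι : Type*} {M : ι → Type*} [∀ a, AddCommGroup (M a)]
    [∀ a, Module F (M a)] {G : ∀ a, ℤ × ℤ → Submodule F (M a)}
    (hG : ∀ a, DirectSum.IsInternal (G a)) : DirectSum.IsInternal (sumGr G) := by
  classical
  refine isInternal_of_proj (fun i => DirectSum.lmap fun a => proj (hG a) i) ?_ ?_
  · intro i j x hx
    rw [mem_sumGr] at hx
    refine DFinsupp.ext fun a => ?_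
    rw [DirectSum.lmap_apply, proj_of_mem (hG a) (hx a)]
    split_ifs <;> rfl
  · rw [eq_top_iff]
    intro x _
    induction x using DirectSum.induction_on with
    | zero => exact Submodule.zero_mem _
    | add a b ha hb => exact Submodule.add_mem _ (ha trivial) (hb trivial)
    | of a x =>
      refine homogeneous_induction (hG a)
        (P := fun x => DirectSum.of M a x ∈ ⨆ i, sumGr G i) x ?_ (by simp) ?_
      · intro i x hx
        refine Submodule.mem_iSup_of_mem i (mem_sumGr.2 fun b => ?_)
        by_cases h : a = b
        · subst h
          rwa [DirectSum.of_eq_same]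
        · rw [DirectSum.of_eq_of_ne _ _ _ (Ne.symm h)]
          exact Submodule.zero_mem _
      · intro x y hx hy
        rw [map_add]
        exact Submodule.add_mem _ hx hy

end Grading

/-! ### Subspaces and quotients of direct sums -/

section DirectSums

variable {F : Type u} [Field F] {V : Type v} [AddCommGroup V] [Module F V] {ι : Type*}
  {M : ι → Type w} [∀ a, AddCommGroup (M a)] [∀ a, Module F (M a)]

theorem exists_directSum_coe_eq (q : ∀ a, Submodule F (M a)) (x : DirectSum ι M)
    (hx : ∀ a, x a ∈ q a) : ∃ y : DirectSum ι fun a => q a, ∀ a, (y a : M a) = x a := by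
  have : x ∈ LinearMap.range (DirectSum.lmap fun a => (q a).subtype) := by
    rw [DirectSum.range_lmap]
    exact fun a _ => ⟨⟨x a, hx a⟩, rfl⟩
  obtain ⟨y, rfl⟩ := this
  exact ⟨y, fun a => rfl⟩

/-- A decomposition of `V` restricts to one of a subspace that is described componentwise. -/
theorem exists_subspaceDecomp (e : V ≃ₗ[F] DirectSum ι M) (p : Submodule F V)
    (q : ∀ a, Submodule F (M a)) (h : ∀ v, v ∈ p ↔ ∀ a, e v a ∈ q a) :
    ∃ e' : p ≃ₗ[F] DirectSum ι fun a => q a, ∀ v a, (e' v a : M a) = e v a := by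
  let j : (DirectSum ι fun a => q a) →ₗ[F] DirectSum ι M := DirectSum.lmap fun a => (q a).subtype
  have hj : Function.Injective j :=
    DirectSum.lmap_injective _ |>.2 fun a => (q a).injective_subtype
  let t : (DirectSum ι fun a => q a) →ₗ[F] p := (e.symm.toLinearMap ∘ₗ j).codRestrict p fun y => by
    rw [h]
    intro a
    simp [j]
  have ht : Function.Bijective t := by
    constructor
    · intro x y hxy
      exact hj (e.symm.injective (congrArg Subtype.val hxy))
    · intro v
      obtain ⟨y, hy⟩ := exists_directSum_coe_eq q (e v) ((h v).1 v.2)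
      refine ⟨y, Subtype.ext (e.symm_apply_eq.2 (DFinsupp.ext fun a => hy a))⟩
  refine ⟨(LinearEquiv.ofBijective t ht).symm, fun v a => ?_⟩
  obtain ⟨y, rfl⟩ := ht.2 v
  rw [show (LinearEquiv.ofBijective t ht).symm (t y) = y from
    (LinearEquiv.ofBijective t ht).symm_apply_apply y]
  simp [t, j]

/-- A decomposition of `V` induces one of a quotient by a subspace that is described
componentwise. -/
theorem exists_quotientDecomp (e : V ≃ₗ[F] DirectSum ι M) (p : Submodule F V)
    (q : ∀ a, Submodule F (M a)) (h : ∀ v, v ∈ p ↔ ∀ a, e v a ∈ q a) :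
    ∃ e' : (V ⧸ p) ≃ₗ[F] DirectSum ι fun a => M a ⧸ q a,
      ∀ v a, e' (p.mkQ v) a = (q a).mkQ (e v a) := by
  let t : V →ₗ[F] DirectSum ι fun a => M a ⧸ q a :=
    (DirectSum.lmap fun a => (q a).mkQ) ∘ₗ e.toLinearMap
  have hk : LinearMap.ker t = p := by
    ext v
    rw [h, LinearMap.mem_ker, DFinsupp.ext_iff]
    exact forall_congr' fun a => Submodule.Quotient.mk_eq_zero _
  have ht : Function.Surjective t :=
    (DirectSum.lmap_surjective _ |>.2 fun a => (q a).mkQ_surjective).comp e.surjective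
  refine ⟨(Submodule.quotEquivOfEq _ _ hk.symm).trans (t.quotKerEquivOfSurjective ht), ?_⟩
  intro v a
  rfl

theorem mem_range_iff_forall {W : Type*} [AddCommGroup W] [Module F W] {N : ι → Type*}
    [∀ a, AddCommGroup (N a)] [∀ a, Module F (N a)] (e : V ≃ₗ[F] DirectSum ι M)
    (e' : W ≃ₗ[F] DirectSum ι N) {T : V →ₗ[F] W} {T' : ∀ a, M a →ₗ[F] N a}
    (h : ∀ v a, e' (T v) a = T' a (e v a)) (w : W) :
    w ∈ LinearMap.range T ↔ ∀ a, e' w a ∈ LinearMap.range (T' a) := by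
  constructor
  · rintro ⟨v, rfl⟩ a
    exact ⟨e v a, (h v a).symm⟩
  · intro hw
    have : e' w ∈ LinearMap.range (DirectSum.lmap T') := by
      rw [DirectSum.range_lmap]
      exact fun a _ => hw a
    obtain ⟨y, hy⟩ := this
    refine ⟨e.symm y, e'.injective (DFinsupp.ext fun a => ?_)⟩
    rw [h, ← hy]
    simp

theorem exists_homologyDecomp (e : V ≃ₗ[F] DirectSum ι M) (d : V →ₗ[F] V)
    (d' : ∀ a, M a →ₗ[F] M a) (h : ∀ v a, e (d v) a = d' a (e v a)) :
    ∃ e' : DHomology d ≃ₗ[F] DirectSum ι fun a => DHomology (d' a),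
      ∀ (z : LinearMap.ker d) a (z' : LinearMap.ker (d' a)), (z' : M a) = e z a →
        e' (DHomology.mk d z) a = DHomology.mk (d' a) z' := by
  obtain ⟨e₁, he₁⟩ := exists_subspaceDecomp e (LinearMap.ker d) (fun a => LinearMap.ker (d' a))
    fun v => by
      simp only [LinearMap.mem_ker, ← h]
      exact ⟨fun hv a => by simp [hv], fun hv => e.map_eq_zero_iff.1 (DFinsupp.ext hv)⟩
  obtain ⟨e₂, he₂⟩ := exists_quotientDecomp e₁ ((LinearMap.range d).submoduleOf (LinearMap.ker d))
    (fun a => (LinearMap.range (d' a)).submoduleOf (LinearMap.ker (d' a))) fun z => by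
      refine (mem_range_iff_forall e e h (z : V)).trans (forall_congr' fun a => ?_)
      rw [← he₁]
      rfl
  refine ⟨e₂, fun z a z' hz => (he₂ z a).trans ?_⟩
  rw [show z' = e₁ z a from Subtype.ext (hz.trans (he₁ z a).symm)]
  rfl

end DirectSums

/-! ### Direct sum decompositions of exact couples -/

/-- An isomorphism of an exact couple with the direct sum of a family of exact couples, compatible
with the bigradings of the `E`-terms. -/
structure CoupleDecomp {F : Type u} [Field F] {ι : Type*} (c : ExactCouple.{u, v} F)
    (c' : ι → ExactCouple.{u, w} F) where
  isoA : c.A ≃ₗ[F] DirectSum ι fun a => (c' a).A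
  isoE : c.E ≃ₗ[F] DirectSum ι fun a => (c' a).E
  map_f : ∀ x a, isoA (c.f x) a = (c' a).f (isoA x a)
  map_g : ∀ x a, isoE (c.g x) a = (c' a).g (isoA x a)
  map_h : ∀ y a, isoA (c.h y) a = (c' a).h (isoE y a)
  mem_grE : ∀ i y, y ∈ c.grE i ↔ ∀ a, isoE y a ∈ (c' a).grE i

namespace CoupleDecomp

variable {F : Type u} [Field F] {ι : Type*} {c : ExactCouple.{u, v} F}
    {c' : ι → ExactCouple.{u, w} F} (θ : CoupleDecomp c c')

theorem map_d (y : c.E) (a : ι) : θ.isoE (c.d y) a = (c' a).d (θ.isoE y a) := by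
  rw [ExactCouple.d, LinearMap.comp_apply, map_g, map_h]
  rfl

theorem mem_ker_d {y : c.E} : y ∈ LinearMap.ker c.d ↔ ∀ a, θ.isoE y a ∈ LinearMap.ker (c' a).d := by
  simp only [LinearMap.mem_ker, ← map_d]
  exact ⟨fun hv a => by simp [hv], fun hv => θ.isoE.map_eq_zero_iff.1 (DFinsupp.ext hv)⟩

theorem exists_derived : ∃ θ' : CoupleDecomp c.derived fun a => (c' a).derived,
    ∀ (y : LinearMap.ker c.d) a (z : LinearMap.ker (c' a).d), (z : (c' a).E) = θ.isoE y a →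
      θ'.isoE (c.toDerived y) a = (c' a).toDerived z := by
  obtain ⟨eA, hA⟩ := exists_subspaceDecomp θ.isoA (LinearMap.range c.f)
    (fun a => LinearMap.range (c' a).f) (mem_range_iff_forall θ.isoA θ.isoA θ.map_f)
  obtain ⟨eE, hE⟩ := exists_homologyDecomp θ.isoE c.d (fun a => (c' a).d) θ.map_d
  have hgr : ∀ i (y : DHomology c.d), y ∈ DHomology.gr c.d c.grE i ↔
      ∀ a, eE y a ∈ DHomology.gr (c' a).d (c' a).grE i := by
    refine fun i y => Iff.symm (Iff.trans (mem_sumGr (F := F)).symm ?_)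
    refine map_gr_iff.1 (map_gr_eq_of_le c.derived.grE_isInternal
      (sumGr_isInternal fun a => (c' a).derived.grE_isInternal) eE ?_) i y
    rintro i _ ⟨z, hz, rfl⟩
    refine mem_sumGr.2 fun a => ?_
    exact ⟨⟨θ.isoE z a, θ.mem_ker_d.1 z.2 a⟩, (θ.mem_grE i z).1 hz a, (hE z a _ rfl).symm⟩
  refine ⟨⟨eA, eE, ?_, ?_, ?_, hgr⟩, hE⟩
  · intro x a
    apply Subtype.ext
    exact (hA _ a).trans ((θ.map_f _ a).trans (congrArg (c' a).f (hA x a).symm))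
  · rintro ⟨_, x, rfl⟩ a
    have h1 : (c.derived.g ⟨c.f x, x, rfl⟩) = _ := c.g'_apply x ⟨c.f x, x, rfl⟩ rfl
    have h2 : ((c' a).derived.g (eA ⟨c.f x, x, rfl⟩ a)) = _ :=
      (c' a).g'_apply (θ.isoA x a) (eA ⟨c.f x, x, rfl⟩ a) ((hA _ a).trans (θ.map_f x a))
    exact (congrArg (fun y => eE y a) h1).trans ((hE _ a _ (θ.map_g x a).symm).trans h2.symm)
  · intro y a
    obtain ⟨z, rfl⟩ := DHomology.mk_surjective c.d y
    apply Subtype.ext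
    have h1 := hE z a ⟨θ.isoE z a, θ.mem_ker_d.1 z.2 a⟩ rfl
    exact (hA _ a).trans ((θ.map_h _ a).trans
      (congrArg Subtype.val (congrArg (c' a).derived.h h1)).symm)

/-- The decomposition of the derived couple. -/
noncomputable def derived : CoupleDecomp c.derived fun a => (c' a).derived :=
  θ.exists_derived.choose

theorem derived_isoE (y : LinearMap.ker c.d) (a : ι) (z : LinearMap.ker (c' a).d)
    (h : (z : (c' a).E) = θ.isoE y a) :
    θ.derived.isoE (c.toDerived y) a = (c' a).toDerived z :=
  θ.exists_derived.choose_spec y a z h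

/-- The decomposition of the couple derived `k` times. -/
noncomputable def iter : ∀ k, CoupleDecomp (c.iter k) fun a => (c' a).iter k
  | 0 => θ
  | k + 1 => (iter k).derived

theorem mem_pull (k : ℕ) (S : Submodule F (c.iter k).E) (S' : ∀ a, Submodule F ((c' a).iter k).E)
    (h : ∀ y, y ∈ S ↔ ∀ a, (θ.iter k).isoE y a ∈ S' a) (y : c.E) :
    y ∈ c.pull k S ↔ ∀ a, θ.isoE y a ∈ (c' a).pull k (S' a) := by
  induction k with
  | zero => exact h y
  | succ k ih =>
    refine ih _ (fun a => ((S' a).comap ((c' a).iter k).toDerived).map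
      (LinearMap.ker ((c' a).iter k).d).subtype) ?_
    intro y
    have key : ∀ (y : LinearMap.ker (c.iter k).d), (c.iter k).toDerived y ∈ S ↔
        ∀ a (z : LinearMap.ker ((c' a).iter k).d), (z : ((c' a).iter k).E) = (θ.iter k).isoE y a →
          ((c' a).iter k).toDerived z ∈ S' a := by
      intro y
      refine (h _).trans (forall_congr' fun a => ⟨fun hy z hz => ?_, fun hy => ?_⟩)
      · have := (θ.iter k).derived_isoE y a z hz
        exact (congrArg (· ∈ S' a) this).mp hy
      · have hz := (θ.iter k).mem_ker_d.1 y.2 a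
        have := (θ.iter k).derived_isoE y a ⟨_, hz⟩ rfl
        exact (congrArg (· ∈ S' a) this).mpr (hy _ rfl)
    constructor
    · rintro ⟨z, hz, rfl⟩ a
      exact ⟨⟨_, (θ.iter k).mem_ker_d.1 z.2 a⟩, (key z).1 hz a _ rfl, rfl⟩
    · intro hy
      have hy' : y ∈ LinearMap.ker (c.iter k).d := (θ.iter k).mem_ker_d.2 fun a => by
        obtain ⟨z, -, hz⟩ := hy a
        rw [← hz]
        exact z.2
      refine ⟨⟨y, hy'⟩, (key _).2 fun a z hz => ?_, rfl⟩
      obtain ⟨z', h1, h2⟩ := hy a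
      rwa [show z = z' from Subtype.ext (hz.trans h2.symm)]

theorem mem_pull_top (k : ℕ) (y : c.E) :
    y ∈ c.pull k ⊤ ↔ ∀ a, θ.isoE y a ∈ (c' a).pull k ⊤ :=
  θ.mem_pull k ⊤ (fun _ => ⊤) (by simp) y

theorem mem_pull_bot (k : ℕ) (y : c.E) :
    y ∈ c.pull k ⊥ ↔ ∀ a, θ.isoE y a ∈ (c' a).pull k ⊥ :=
  θ.mem_pull k ⊥ (fun _ => ⊥) (fun y => by
    simp only [Submodule.mem_bot]
    exact ⟨fun hv a => by simp [hv],
      fun hv => (θ.iter k).isoE.map_eq_zero_iff.1 (DFinsupp.ext hv)⟩) y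

end CoupleDecomp

namespace ExactCouple

variable {F : Type u} [Field F] (c : ExactCouple.{u, v} F)

theorem pull_mono (k : ℕ) {S T : Submodule F (c.iter k).E} (h : S ≤ T) :
    c.pull k S ≤ c.pull k T := by
  induction k with
  | zero => exact h
  | succ k ih => exact ih (Submodule.map_mono (Submodule.comap_mono h))

theorem monotone_pull_bot : Monotone fun k => c.pull k ⊥ :=
  monotone_nat_of_le_succ fun k => c.pull_mono k bot_le

theorem mem_Zinf {y : c.E} : y ∈ c.Zinf ↔ ∀ k, y ∈ c.pull k ⊤ := Submodule.mem_iInf _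

theorem mem_Binf {y : c.E} : y ∈ c.Binf ↔ ∃ k, y ∈ c.pull k ⊥ :=
  Submodule.mem_iSup_of_directed _ c.monotone_pull_bot.directed_le

end ExactCouple

namespace CoupleDecomp

variable {F : Type u} [Field F] {ι : Type*} {c : ExactCouple.{u, v} F}
    {c' : ι → ExactCouple.{u, w} F} (θ : CoupleDecomp c c')

theorem mem_Zinf (y : c.E) : y ∈ c.Zinf ↔ ∀ a, θ.isoE y a ∈ (c' a).Zinf := by
  simp only [ExactCouple.mem_Zinf, θ.mem_pull_top]
  exact forall_comm

theorem mem_Binf (y : c.E) : y ∈ c.Binf ↔ ∀ a, θ.isoE y a ∈ (c' a).Binf := by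
  classical
  simp only [ExactCouple.mem_Binf, θ.mem_pull_bot]
  refine ⟨fun ⟨k, hk⟩ a => ⟨k, hk a⟩, fun h => ?_⟩
  -- Only finitely many components are nonzero, so one page serves for all of them.
  choose k hk using h
  refine ⟨(DFinsupp.support (θ.isoE y)).sup k, fun a => ?_⟩
  by_cases ha : a ∈ DFinsupp.support (θ.isoE y)
  · exact (c' a).monotone_pull_bot (Finset.le_sup ha) (hk a)
  · rw [DFinsupp.notMem_support_iff.1 ha]
    exact Submodule.zero_mem _

theorem exists_isoInf : ∃ e : c.Einf ≃ₗ[F] DirectSum ι fun a => (c' a).Einf,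
    ∀ (y : c.Zinf) a (z : (c' a).Zinf), (z : (c' a).E) = θ.isoE y a →
      e ((c.Binf.submoduleOf c.Zinf).mkQ y) a =
        ((c' a).Binf.submoduleOf (c' a).Zinf).mkQ z := by
  obtain ⟨e₁, he₁⟩ := exists_subspaceDecomp θ.isoE c.Zinf (fun a => (c' a).Zinf) θ.mem_Zinf
  obtain ⟨e₂, he₂⟩ := exists_quotientDecomp e₁ (c.Binf.submoduleOf c.Zinf)
    (fun a => (c' a).Binf.submoduleOf (c' a).Zinf) fun z => by
      refine (θ.mem_Binf (z : c.E)).trans (forall_congr' fun a => ?_)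
      rw [← he₁]
      rfl
  refine ⟨e₂, fun z a z' hz => (he₂ z a).trans ?_⟩
  rw [show z' = e₁ z a from Subtype.ext (hz.trans (he₁ z a).symm)]

end CoupleDecomp

namespace ExactCouple

variable {F : Type u} [Field F] (c : ExactCouple.{u, v} F)

theorem d_proj (i : ℤ × ℤ) (y : c.E) :
    c.d (proj c.grE_isInternal i y) = proj c.grE_isInternal (i + (c.degH + c.degG)) (c.d y) :=
  (proj_map _ _ c.d _ c.d_mem i y).symm

theorem toDerived_mem (i : ℤ × ℤ) (z : LinearMap.ker c.d) (hz : (z : c.E) ∈ c.grE i) :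
    c.toDerived z ∈ c.derived.grE i :=
  ⟨z, hz, rfl⟩

/-- The subspaces `Z^r` and `B^r` of the first page are graded. -/
theorem proj_mem_pull (k : ℕ) (S : Submodule F (c.iter k).E)
    (hS : ∀ i, ∀ y ∈ S, proj (c.iter k).grE_isInternal i y ∈ S) (i : ℤ × ℤ) (y : c.E)
    (hy : y ∈ c.pull k S) : proj c.grE_isInternal i y ∈ c.pull k S := by
  induction k with
  | zero => exact hS i y hy
  | succ k ih =>
    refine ih _ ?_ hy
    rintro i _ ⟨z, hz, rfl⟩
    have hk : proj (c.iter k).grE_isInternal i z ∈ LinearMap.ker (c.iter k).d := by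
      rw [LinearMap.mem_ker, d_proj, LinearMap.mem_ker.1 z.2, map_zero]
    refine ⟨⟨_, hk⟩, ?_, rfl⟩
    have h1 := isInternal_comap (c.iter k).grE_isInternal (LinearMap.ker (c.iter k).d).subtype
      (Submodule.injective_subtype _) (by
        intro i z
        refine ⟨⟨_, ?_⟩, rfl⟩
        exact ((c.iter k).d_proj i z).trans ((congrArg _ z.2).trans (map_zero _)))
    have h2 : proj h1 i z = ⟨_, hk⟩ := Subtype.ext <| by
      have := proj_map h1 (c.iter k).grE_isInternal (LinearMap.ker (c.iter k).d).subtype 0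
        (fun i v hv => by simpa using hv) i z
      simpa using this.symm
    have h3 := proj_map h1 (c.iter (k + 1)).grE_isInternal (c.iter k).toDerived 0
      (fun i v hv => by rw [add_zero]; exact toDerived_mem _ i v hv) i z
    rw [add_zero, h2] at h3
    exact (congrArg (· ∈ S) h3).mp (hS i _ hz)

theorem proj_mem_Zinf (i : ℤ × ℤ) (y : c.E) (hy : y ∈ c.Zinf) :
    proj c.grE_isInternal i y ∈ c.Zinf :=
  c.mem_Zinf.2 fun k => c.proj_mem_pull k ⊤ (by simp) i y (c.mem_Zinf.1 hy k)

theorem proj_mem_Binf (i : ℤ × ℤ) (y : c.E) (hy : y ∈ c.Binf) :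
    proj c.grE_isInternal i y ∈ c.Binf := by
  obtain ⟨k, hk⟩ := c.mem_Binf.1 hy
  exact c.mem_Binf.2 ⟨k, c.proj_mem_pull k ⊥ (by simp) i y hk⟩

theorem grEinf_isInternal : DirectSum.IsInternal c.grEinf := by
  have h1 := isInternal_comap c.grE_isInternal c.Zinf.subtype (Submodule.injective_subtype _)
    fun i z => ⟨⟨_, c.proj_mem_Zinf i z z.2⟩, rfl⟩
  refine isInternal_map h1 _ (Submodule.mkQ_surjective _) fun i z hz => ?_
  have h2 := proj_map h1 c.grE_isInternal c.Zinf.subtype 0 (fun i v hv => by simpa using hv) i z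
  rw [Submodule.mkQ_apply, Submodule.Quotient.mk_eq_zero] at hz ⊢
  have : (proj h1 i z : c.E) = proj c.grE_isInternal i z := by simpa using h2.symm
  change (proj h1 i z : c.E) ∈ c.Binf
  rw [this]
  exact c.proj_mem_Binf i z hz

end ExactCouple

/-- A decomposition of the first exact couple induces one of the spectral sequence. -/
theorem exists_spectralDecomp {F : Type u} [Field F] {ι : Type*} {K : GradedComplex.{u, v} F}
    {L : ι → GradedComplex.{u, w} F} (θ : CoupleDecomp K.couple fun a => (L a).couple) :
    ∃ Ψ : SpectralDecomp K L, Ψ.iso 0 = θ.isoE := by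
  obtain ⟨eI, hI⟩ := θ.exists_isoInf
  have hmem : ∀ (y : K.couple.Zinf) a, ∃ z : (L a).couple.Zinf,
      (z.1 : (L a).page 0) = θ.isoE y a ∧ eI (K.toPageInf y) a = (L a).toPageInf z :=
    fun y a => ⟨⟨_, (θ.mem_Zinf _).1 y.2 a⟩, rfl, hI y a _ rfl⟩
  refine ⟨⟨fun k => (θ.iter k).isoE, fun k => ?_, fun k => (θ.iter k).map_d,
    fun k y a z h => (θ.iter k).derived_isoE y a z h, eI, ?_, hmem⟩, rfl⟩
  · exact map_gr_iff.2 fun i v => mem_sumGr.trans ((θ.iter k).mem_grE i v).symm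
  · refine map_gr_eq_of_le K.couple.grEinf_isInternal
      (sumGr_isInternal fun a => (L a).couple.grEinf_isInternal) eI ?_
    rintro i _ ⟨y, hy, rfl⟩
    refine mem_sumGr.2 fun a => ?_
    exact ⟨⟨_, (θ.mem_Zinf _).1 y.2 a⟩, (θ.mem_grE i _).1 hy a, (hI y a _ rfl).symm⟩

/-! ### Extending an isomorphism of homology to the exact couples -/

theorem exists_comp_comp_eq_self {F V W : Type*} [Field F] [AddCommGroup V] [Module F V]
    [AddCommGroup W] [Module F W] (T : V →ₗ[F] W) : ∃ S : W →ₗ[F] V, ∀ v, T (S (T v)) = T v := by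
  obtain ⟨s, hs⟩ := T.rangeRestrict.exists_rightInverse_of_surjective T.range_rangeRestrict
  obtain ⟨S, hS⟩ := LinearMap.exists_extend s
  refine ⟨S, fun v => ?_⟩
  have h1 : S (T v) = s (T.rangeRestrict v) := LinearMap.congr_fun hS (T.rangeRestrict v)
  rw [h1]
  exact congrArg Subtype.val (LinearMap.congr_fun hs (T.rangeRestrict v))

theorem exact_lmap {F : Type*} [Field F] {ι : Type*} {M N P : ι → Type*}
    [∀ a, AddCommGroup (M a)] [∀ a, Module F (M a)] [∀ a, AddCommGroup (N a)]
    [∀ a, Module F (N a)] [∀ a, AddCommGroup (P a)] [∀ a, Module F (P a)]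
    {f : ∀ a, M a →ₗ[F] N a} {g : ∀ a, N a →ₗ[F] P a} (h : ∀ a, Function.Exact (f a) (g a)) :
    Function.Exact (DirectSum.lmap f) (DirectSum.lmap g) := by
  intro y
  refine Iff.trans ?_ (mem_range_iff_forall (LinearEquiv.refl F _) (LinearEquiv.refl F _)
    (fun v a => rfl) y).symm
  rw [DFinsupp.ext_iff]
  exact forall_congr' fun a => h a (y a)

/-- Given isomorphic maps `f` and `f'`, the middle terms of exact triangles over `f` and `f'` are
compared by a linear map: as vector spaces they are the sums of a cokernel and a kernel. -/
theorem exists_map_of_exact {F A E A' E' : Type*} [Field F] [AddCommGroup A] [Module F A]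
    [AddCommGroup E] [Module F E] [AddCommGroup A'] [Module F A'] [AddCommGroup E'] [Module F E']
    {f : A →ₗ[F] A} {g : A →ₗ[F] E} {h : E →ₗ[F] A}
    {f' : A' →ₗ[F] A'} {g' : A' →ₗ[F] E'} {h' : E' →ₗ[F] A'}
    (hfg : Function.Exact f g) (hgh : Function.Exact g h) (hhf : Function.Exact h f)
    (hfg' : Function.Exact f' g') (hgh' : Function.Exact g' h') (hhf' : Function.Exact h' f')
    (φ : A →ₗ[F] A') (hφ : ∀ x, φ (f x) = f' (φ x)) :
    ∃ ψ : E →ₗ[F] E', (∀ x, ψ (g x) = g' (φ x)) ∧ ∀ y, h' (ψ y) = φ (h y) := by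
  obtain ⟨τ, hτ⟩ := exists_comp_comp_eq_self h
  obtain ⟨ρ, hρ⟩ := exists_comp_comp_eq_self g
  obtain ⟨τ', hτ'⟩ := exists_comp_comp_eq_self h'
  refine ⟨g' ∘ₗ φ ∘ₗ ρ ∘ₗ (LinearMap.id - τ ∘ₗ h) + τ' ∘ₗ φ ∘ₗ h, fun x => ?_, fun y => ?_⟩
  · have h1 : g (ρ (g x) - x) = 0 := by rw [map_sub, hρ, sub_self]
    obtain ⟨b, hb⟩ := (hfg _).1 h1
    have h2 : g' (φ (ρ (g x) - x)) = 0 := by rw [← hb, hφ, hfg'.apply_apply_eq_zero]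
    rw [map_sub, map_sub, sub_eq_zero] at h2
    simp [hgh.apply_apply_eq_zero, h2]
  · have h1 : f' (φ (h y)) = 0 := by rw [← hφ, hhf.apply_apply_eq_zero, map_zero]
    obtain ⟨e, he⟩ := (hhf' _).1 h1
    simp [hgh'.apply_apply_eq_zero, ← he, hτ']

/-- An isomorphism of the `A`-terms that commutes with `f` extends to a decomposition of the exact
couple. -/
theorem exists_coupleDecomp {F : Type u} [Field F] {ι : Type*} {c : ExactCouple.{u, v} F}
    {c' : ι → ExactCouple.{u, w} F} (φ : c.A ≃ₗ[F] DirectSum ι fun a => (c' a).A)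
    (hφ : ∀ x a, φ (c.f x) a = (c' a).f (φ x a))
    (hgr : ∀ i, ∀ x ∈ c.grA i, ∀ a, φ x a ∈ (c' a).grA i)
    (hG : ∀ a, (c' a).degG = c.degG) (hH : ∀ a, (c' a).degH = c.degH) :
    ∃ θ : CoupleDecomp c c', θ.isoA = φ := by
  have hI := sumGr_isInternal fun a => (c' a).grE_isInternal
  have hfg := exact_lmap fun a => (c' a).exact_fg
  have hgh := exact_lmap fun a => (c' a).exact_gh
  have hhf := exact_lmap fun a => (c' a).exact_hf
  have hφ' : ∀ x, φ (c.f x) = DirectSum.lmap (fun a => (c' a).f) (φ x) :=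
    fun x => DFinsupp.ext (hφ x)
  obtain ⟨ψ₀, hg₀, hh₀⟩ := exists_map_of_exact c.exact_fg c.exact_gh c.exact_hf hfg hgh hhf
    φ.toLinearMap hφ'
  -- The part of degree `0` of `ψ₀` still commutes with the structure maps.
  let ψ := homogenize c.grE_isInternal hI 0 ψ₀
  have hψ : ∀ i, ∀ y ∈ c.grE i, ψ y = proj hI i (ψ₀ y) := fun i y hy => by
    have := homogenize_of_mem c.grE_isInternal hI 0 ψ₀ hy
    rwa [add_zero] at this
  have hg : ∀ x, ψ (c.g x) = DirectSum.lmap (fun a => (c' a).g) (φ x) := by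
    refine linearMap_ext_homogeneous c.grA_isInternal (S := ψ ∘ₗ c.g)
      (T := DirectSum.lmap (fun a => (c' a).g) ∘ₗ φ.toLinearMap) fun i x hx => ?_
    refine (hψ _ _ (c.g_mem i x hx)).trans ?_
    rw [hg₀]
    refine (mem_iff_proj_eq hI).1 (mem_sumGr.2 fun a => ?_)
    rw [← hG a]
    exact (c' a).g_mem i _ (hgr i x hx a)
  have hIA := sumGr_isInternal fun a => (c' a).grA_isInternal
  have hh : ∀ y, DirectSum.lmap (fun a => (c' a).h) (ψ y) = φ (c.h y) := by
    refine linearMap_ext_homogeneous c.grE_isInternal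
      (S := DirectSum.lmap (fun a => (c' a).h) ∘ₗ ψ) (T := φ.toLinearMap ∘ₗ c.h) fun i y hy => ?_
    change DirectSum.lmap (fun a => (c' a).h) (ψ y) = φ (c.h y)
    rw [hψ i y hy, ← proj_map hI hIA (DirectSum.lmap fun a => (c' a).h) c.degH (fun i y hy =>
      mem_sumGr.2 fun a => by
        rw [← hH a]
        exact (c' a).h_mem i _ (mem_sumGr.1 hy a)), hh₀]
    exact (mem_iff_proj_eq hIA).1 (mem_sumGr.2 (hgr _ _ (c.h_mem i y hy)))
  have hbij : Function.Bijective ψ :=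
    LinearMap.bijective_of_surjective_of_bijective_of_bijective_of_injective
      c.f c.g c.h c.f (DirectSum.lmap fun a => (c' a).f) (DirectSum.lmap fun a => (c' a).g)
      (DirectSum.lmap fun a => (c' a).h) (DirectSum.lmap fun a => (c' a).f)
      φ.toLinearMap φ.toLinearMap ψ φ.toLinearMap φ.toLinearMap
      (LinearMap.ext fun x => (hφ' x).symm) (LinearMap.ext fun x => (hg x).symm)
      (LinearMap.ext hh) (LinearMap.ext fun x => (hφ' x).symm)
      c.exact_fg c.exact_gh c.exact_hf hfg hgh hhf
      φ.surjective φ.bijective φ.bijective φ.injective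
  refine ⟨⟨φ, LinearEquiv.ofBijective ψ hbij, hφ, fun x a => ?_, fun y a => ?_, fun i y => ?_⟩, rfl⟩
  · exact DFunLike.congr_fun (hg x) a
  · exact (DFunLike.congr_fun (hh y) a).symm
  · rw [← mem_sumGr]
    refine (map_gr_iff.1 (map_gr_eq_of_le c.grE_isInternal hI
      (LinearEquiv.ofBijective ψ hbij) fun i y hy => ?_) i y).symm
    have := homogenize_mem c.grE_isInternal hI 0 ψ₀ i y hy
    rwa [add_zero] at this

theorem HomologyDecomp.exists_inducedBy {F : Type u} [Field F] {ι : Type*}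
    {K : GradedComplex.{u, v} F} {L : ι → GradedComplex.{u, w} F} (Φ : HomologyDecomp K L) :
    ∃ Ψ : SpectralDecomp K L, Ψ.InducedBy Φ := by
  obtain ⟨θ, hθ⟩ := exists_coupleDecomp (c := K.couple) (c' := fun a => (L a).couple)
    (Φ.iso.restrictScalars F)
    (fun x a => DFunLike.congr_fun (Φ.iso.map_smul X x) a)
    (fun i x hx a => by
      have : Φ.iso x ∈ sumGr (fun a => (L a).grH) i := by
        rw [← Φ.map_gr i]
        exact ⟨x, hx, rfl⟩
      exact mem_sumGr.1 this a)
    (fun _ => rfl) (fun _ => rfl)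
  obtain ⟨Ψ, hΨ⟩ := exists_spectralDecomp θ
  refine ⟨Ψ, fun x a => ?_, fun y a => ?_⟩
  · have := θ.map_g x a
    rw [hθ] at this
    rw [hΨ]
    exact this
  · have := θ.map_h y a
    rw [hθ] at this
    rw [hΨ]
    exact this

/-! ### The spectral sequences of the elementary complexes -/

theorem BigradedIso.eq_bot_of_eq_bot {F : Type u} [Field F] {V : Type v} [AddCommGroup V]
    [Module F V] {W : Type w} [AddCommGroup W] [Module F W] {G : ℤ × ℤ → Submodule F V}
    {H : ℤ × ℤ → Submodule F W} (h : BigradedIso G H) {i : ℤ × ℤ} (hi : H i = ⊥) : G i = ⊥ := by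
  obtain ⟨e, he⟩ := h
  rw [map_gr_iff] at he
  refine (Submodule.eq_bot_iff _).2 fun v hv => ?_
  rw [← he, hi, Submodule.mem_bot] at hv
  exact e.map_eq_zero_iff.1 hv

namespace ExactCouple

variable {F : Type u} [Field F] {c : ExactCouple.{u, v} F}

theorem toDerived_injective (hd : c.d = 0) : Function.Injective c.toDerived := by
  rw [injective_iff_map_eq_zero]
  intro z hz
  obtain ⟨y, hy⟩ := (DHomology.mk_eq_zero c.d z).1 hz
  exact Subtype.ext (by rw [← hy, hd]; rfl)

theorem derived_bigradedIso (hd : c.d = 0) : BigradedIso c.derived.grE c.grE := by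
  have hk : ∀ y, y ∈ LinearMap.ker c.d := fun y => by rw [hd]; rfl
  let t : c.E →ₗ[F] c.derived.E := c.toDerived ∘ₗ LinearMap.id.codRestrict (LinearMap.ker c.d) hk
  have ht : Function.Bijective t := by
    constructor
    · exact (toDerived_injective hd).comp fun x y h => congrArg Subtype.val h
    · intro y
      obtain ⟨z, rfl⟩ := DHomology.mk_surjective c.d y
      exact ⟨z, rfl⟩
  refine BigradedIso.symm (BigradedIso.of_iff (LinearEquiv.ofBijective t ht) fun i y => ?_)
  refine ⟨?_, fun hy => ⟨⟨y, hk y⟩, hy, rfl⟩⟩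
  rintro ⟨z, hz, hzy⟩
  have : z = ⟨y, hk y⟩ := toDerived_injective hd hzy
  rw [this] at hz
  exact hz

theorem d_eq_zero_of_support (S : Set (ℤ × ℤ)) (hS : ∀ i ∉ S, c.grE i = ⊥)
    (h : ∀ i ∈ S, i + (c.degH + c.degG) ∉ S) : c.d = 0 := by
  refine LinearMap.ext fun y => linearMap_ext_homogeneous c.grE_isInternal (fun i y hy => ?_) y
  by_cases hi : i ∈ S
  · have := c.d_mem i y hy
    rw [hS _ (h i hi)] at this
    exact this
  · rw [hS i hi] at hy
    rw [(Submodule.mem_bot F).1 hy, map_zero, map_zero]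

theorem iter_degH (k : ℕ) : (c.iter k).degH = c.degH := by
  induction k with
  | zero => rfl
  | succ k ih => exact ih

theorem iter_degF (k : ℕ) : (c.iter k).degF = c.degF := by
  induction k with
  | zero => rfl
  | succ k ih => exact ih

theorem iter_degG (k : ℕ) : (c.iter k).degG = c.degG - k • c.degF := by
  induction k with
  | zero => simp [iter]
  | succ k ih =>
    have : (c.iter (k + 1)).degG = (c.iter k).degG - (c.iter k).degF := rfl
    rw [this, ih, iter_degF, succ_nsmul, sub_sub]

theorem bigradedIso_of_d_eq_zero (k : ℕ) (h : ∀ j < k, (c.iter j).d = 0) :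
    BigradedIso (c.iter k).grE c.grE := by
  induction k with
  | zero => exact BigradedIso.refl _
  | succ k ih =>
    exact (derived_bigradedIso (h k k.lt_succ_self)).trans
      (ih fun j hj => h j (hj.trans k.lt_succ_self))

/-- The differentials of the pages vanish as long as their bidegrees do not connect two bidegrees
in the support of the first page. -/
theorem iter_d_eq_zero_of_support (S : Set (ℤ × ℤ)) (hS : ∀ i ∉ S, c.grE i = ⊥) (k : ℕ)
    (h : ∀ j < k, ∀ i ∈ S, i + (c.degH + (c.degG - j • c.degF)) ∉ S) :
    ∀ j < k, (c.iter j).d = 0 := by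
  intro j
  induction j using Nat.strong_induction_on with
  | _ j ih =>
    intro hj
    have he := bigradedIso_of_d_eq_zero j fun l hl => ih l hl (hl.trans hj)
    refine d_eq_zero_of_support S (fun i hi => he.eq_bot_of_eq_bot (hS i hi)) ?_
    · rw [iter_degH, iter_degG]
      exact h j hj

theorem pull_top_eq_top (h : ∀ k, (c.iter k).d = 0) (k : ℕ) : c.pull k ⊤ = ⊤ := by
  induction k with
  | zero => rfl
  | succ k ih =>
    refine Eq.trans (congrArg (c.pull k) ?_) ih
    refine (Submodule.map_subtype_top _).trans ?_
    rw [h k, LinearMap.ker_zero]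

theorem pull_bot_eq_bot (h : ∀ k, (c.iter k).d = 0) (k : ℕ) : c.pull k ⊥ = ⊥ := by
  induction k with
  | zero => rfl
  | succ k ih =>
    refine Eq.trans (congrArg (c.pull k) ?_) ih
    refine (congrArg (Submodule.map _) ?_).trans (Submodule.map_bot _)
    exact LinearMap.ker_eq_bot.2 (toDerived_injective (h k))

/-- A spectral sequence without nonzero differentials has limit page `E^(1)`. -/
theorem grEinf_bigradedIso (h : ∀ k, (c.iter k).d = 0) : BigradedIso c.grEinf c.grE := by
  have hZ : ∀ y, y ∈ c.Zinf := fun y => c.mem_Zinf.2 fun k => by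
    rw [pull_top_eq_top h]
    trivial
  have hB : c.Binf = ⊥ := by simp [Binf, pull_bot_eq_bot h]
  let q := (c.Binf.submoduleOf c.Zinf).mkQ
  have hq : Function.Injective q := by
    rw [injective_iff_map_eq_zero]
    intro z hz
    have hz' : z ∈ c.Binf.submoduleOf c.Zinf := (Submodule.Quotient.mk_eq_zero _).1 hz
    replace hz' : (z : c.E) ∈ c.Binf := hz'
    rw [hB] at hz'
    exact Subtype.ext hz'
  let t : c.E →ₗ[F] c.Einf := q ∘ₗ LinearMap.id.codRestrict c.Zinf hZ
  have ht : Function.Bijective t := by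
    constructor
    · exact hq.comp fun x y h => congrArg Subtype.val h
    · intro y
      obtain ⟨z, rfl⟩ := Submodule.mkQ_surjective _ y
      exact ⟨z, rfl⟩
  refine BigradedIso.symm (BigradedIso.of_iff (LinearEquiv.ofBijective t ht) fun i y => ?_)
  refine ⟨?_, fun hy => ⟨⟨y, hZ y⟩, hy, rfl⟩⟩
  rintro ⟨z, hz, hzy⟩
  have : z = ⟨y, hZ y⟩ := hq hzy
  rw [this] at hz
  exact hz

theorem subsingleton_E (h : Subsingleton c.A) : Subsingleton c.E := by
  refine subsingleton_of_forall_eq 0 fun y => ?_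
  obtain ⟨x, rfl⟩ := (c.exact_gh y).1 (Subsingleton.elim _ _)
  rw [Subsingleton.elim x 0, map_zero]

theorem subsingleton_iter_A {m : ℕ} (hm : ∀ x, (c.f ^ m) x = 0) {k : ℕ} (hk : m ≤ k) :
    Subsingleton (c.iter k).A := by
  have key : ∀ k l, (∀ x, (c.f ^ (l + k)) x = 0) → ∀ x, ((c.iter k).f ^ l) x = 0 := by
    intro k
    induction k with
    | zero => exact fun l h => h
    | succ k ih =>
      intro l h x
      have h1 := ih (l + 1) (by rwa [add_right_comm] )
      have h2 : ∀ l (x : LinearMap.range (c.iter k).f),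
          ((((c.iter k).f' ^ l) x : LinearMap.range (c.iter k).f) : (c.iter k).A) =
            ((c.iter k).f ^ l) x := by
        intro l
        induction l with
        | zero => exact fun _ => rfl
        | succ l ih => intro x; rw [pow_succ, pow_succ, Module.End.mul_apply, ih]; rfl
      obtain ⟨_, y, rfl⟩ := x
      refine Subtype.ext ((h2 l _).trans ?_)
      have := h1 y
      rwa [pow_succ, Module.End.mul_apply] at this
  refine subsingleton_of_forall_eq 0 fun x => ?_
  refine key k 0 (fun x => ?_) x
  obtain ⟨l, rfl⟩ := Nat.exists_eq_add_of_le' hk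
  rw [zero_add, pow_add, Module.End.mul_apply, hm, map_zero]

theorem subsingleton_Einf {k : ℕ} (h : Subsingleton (c.iter k).E) : Subsingleton c.Einf := by
  refine subsingleton_of_forall_eq 0 fun y => ?_
  obtain ⟨z, rfl⟩ := Submodule.mkQ_surjective _ y
  rw [Submodule.mkQ_apply, Submodule.Quotient.mk_eq_zero]
  refine c.mem_Binf.2 ⟨k, ?_⟩
  have := c.mem_Zinf.1 z.2 k
  rwa [Subsingleton.elim (⊤ : Submodule F (c.iter k).E) ⊥] at this

end ExactCouple

section FirstPage

variable {F : Type u} [Field F]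

theorem lineGr_isInternal (n s : ℤ) : DirectSum.IsInternal (lineGr F n s) := by
  refine isInternal_of_proj (fun i => if i = (n, s) then LinearMap.id else 0) ?_ ?_
  · intro i j v hv
    by_cases hi : i = (n, s)
    · subst hi
      by_cases hj : j = (n, s)
      · simp [hj]
      · simp [hj, Ne.symm hj]
    · rw [lineGr, if_neg hi, Submodule.mem_bot] at hv
      simp [hv]
  · refine eq_top_iff.2 (le_trans ?_ (le_iSup _ (n, s)))
    rw [lineGr, if_pos rfl]

/-- If the differential of `K / xK` vanishes, the first page is `K / xK`. -/
theorem grE_bigradedIso_of_dvd (K : GradedComplex.{u, v} F)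
    (hK : ∀ k, ∃ k', (X : F[X]) • k' = K.d k) {V : Type w} [AddCommGroup V] [Module F V]
    {H : ℤ × ℤ → Submodule F V} (hH : DirectSum.IsInternal H) (T : K.carrier →ₗ[F] V)
    (hT : Function.Surjective T) (hker : ∀ k, T k = 0 ↔ ∃ k', (X : F[X]) • k' = k)
    (hgr : ∀ i, ∀ k ∈ K.gr i, T k ∈ H i) : BigradedIso K.couple.grE H := by
  have hd : ∀ k, K.dQ (K.toQ k) = 0 := fun k => by
    rw [← K.toQ_d, K.toQ_eq_zero]
    exact hK k
  let q : K.carrier →ₗ[F] K.HQ := ((DHomology.mk K.dQ) ∘ₗ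
    K.toQ.codRestrict (LinearMap.ker K.dQ) hd).restrictScalars F
  have hq : Function.Surjective q := by
    intro y
    obtain ⟨⟨z, hz⟩, rfl⟩ := DHomology.mk_surjective K.dQ y
    obtain ⟨k, rfl⟩ := K.toQ_surjective z
    exact ⟨k, rfl⟩
  have hqT : LinearMap.ker q = LinearMap.ker T := by
    ext k
    rw [LinearMap.mem_ker, LinearMap.mem_ker, hker, ← K.toQ_eq_zero]
    refine (DHomology.mk_eq_zero K.dQ _).trans ⟨?_, fun h => ⟨0, by rw [map_zero]; exact h.symm⟩⟩
    rintro ⟨y, hy⟩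
    obtain ⟨l, rfl⟩ := K.toQ_surjective y
    rw [hd] at hy
    exact hy.symm
  let e : K.HQ ≃ₗ[F] V := ((q.quotKerEquivOfSurjective hq).symm.trans
    (Submodule.quotEquivOfEq _ _ hqT)).trans (T.quotKerEquivOfSurjective hT)
  have he : ∀ k, e (q k) = T k := by
    intro k
    have : (q.quotKerEquivOfSurjective hq).symm (q k) = Submodule.Quotient.mk k := by
      rw [LinearEquiv.symm_apply_eq]
      rfl
    simp only [e, LinearEquiv.trans_apply, this]
    rfl
  refine ⟨e, map_gr_eq_of_le K.couple.grE_isInternal hH e ?_⟩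
  rintro i _ ⟨⟨_, hz⟩, ⟨k, hk, rfl⟩, rfl⟩
  have := he k
  change e (q k) ∈ H i
  rw [this]
  exact hgr i k hk

theorem coeff_zero_mem_lineGr {n s : ℤ} {i : ℤ × ℤ} {q : F[X]} (hq : q ∈ polyGr F n s i) :
    q.coeff 0 ∈ lineGr F n s i := by
  rw [lineGr]
  split_ifs with h
  · trivial
  · by_contra h0
    exact h (by simpa using hq 0 h0)

theorem coeff_zero_eq_zero_iff {q : F[X]} : q.coeff 0 = 0 ↔ ∃ r, (X : F[X]) • r = q := by
  rw [← X_dvd_iff]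
  exact ⟨fun ⟨r, hr⟩ => ⟨r, hr.symm⟩, fun ⟨r, hr⟩ => ⟨r, hr.symm⟩⟩

theorem Ufree_grE (n s : ℤ) : BigradedIso (Ufree F n s).couple.grE (lineGr F n s) :=
  grE_bigradedIso_of_dvd (Ufree F n s) (fun _ => ⟨0, smul_zero _⟩) (lineGr_isInternal n s)
    (lcoeff F 0) (fun a => ⟨C a, coeff_C_zero⟩) (fun _ => coeff_zero_eq_zero_iff)
    fun _ _ => coeff_zero_mem_lineGr

/-- The constant terms of a pair of polynomials. -/
noncomputable def constTerms (F : Type u) [Field F] : F[X] × F[X] →ₗ[F] F × F :=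
  (lcoeff F 0).prodMap (lcoeff F 0)

theorem Utors_grE (n s : ℤ) {m : ℕ} (hm : 0 < m) : BigradedIso (Utors F n s m).couple.grE
    (fun i => (lineGr F (n + 1) (s + m) i).prod (lineGr F n s i)) := by
  have h1 : ∀ k : F[X] × F[X], ∃ k' : F[X] × F[X],
      (X : F[X]) • k' = (Utors F n s m).d k := by
    rintro ⟨a, b⟩
    refine ⟨(0, X ^ (m - 1) * a), Prod.ext (mul_zero X) ?_⟩
    change X * (X ^ (m - 1) * a) = X ^ m * a
    rw [← mul_assoc, mul_pow_sub_one hm.ne']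
  have h2 : Function.Surjective (constTerms F) := fun a =>
    ⟨(C a.1, C a.2), Prod.ext coeff_C_zero coeff_C_zero⟩
  have h3 : ∀ k, constTerms F k = 0 ↔ ∃ k', (X : F[X]) • k' = k := by
    rintro ⟨a, b⟩
    rw [constTerms, LinearMap.prodMap_apply, Prod.mk_eq_zero]
    refine (and_congr coeff_zero_eq_zero_iff coeff_zero_eq_zero_iff).trans ?_
    constructor
    · rintro ⟨⟨a', rfl⟩, b', rfl⟩
      exact ⟨(a', b'), rfl⟩
    · rintro ⟨⟨a', b'⟩, h⟩
      exact ⟨⟨a', congrArg Prod.fst h⟩, b', congrArg Prod.snd h⟩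
  have hI := prodGr_isInternal (lineGr_isInternal (F := F) (n + 1) (s + m))
    (lineGr_isInternal (F := F) n s)
  refine grE_bigradedIso_of_dvd (Utors F n s m) h1 hI (constTerms F) h2 h3
    fun i k hk => ⟨coeff_zero_mem_lineGr hk.1, coeff_zero_mem_lineGr hk.2⟩

theorem Ufree_iter_d (n s : ℤ) (k : ℕ) : ((Ufree F n s).couple.iter k).d = 0 := by
  refine ExactCouple.iter_d_eq_zero_of_support {(n, s)} (fun i hi => ?_) (k + 1) ?_ k
    k.lt_succ_self
  · exact (Ufree_grE n s).eq_bot_of_eq_bot (if_neg hi)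
  · rintro j - i rfl hi
    have := congrArg Prod.fst hi
    simp [GradedComplex.couple] at this

theorem Utors_iter_d (n s : ℤ) {m k : ℕ} (hk : k + 1 < m) :
    ((Utors F n s m).couple.iter k).d = 0 := by
  refine ExactCouple.iter_d_eq_zero_of_support {(n + 1, s + m), (n, s)} (fun i hi => ?_) (k + 1) ?_
    k k.lt_succ_self
  · simp only [Set.mem_insert_iff, Set.mem_singleton_iff, not_or] at hi
    refine (Utors_grE n s (by omega)).eq_bot_of_eq_bot ?_
    rw [lineGr, lineGr, if_neg hi.1, if_neg hi.2, Submodule.prod_bot]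
  · rintro j hj i hi hi'
    have hδ : (Utors F n s m).couple.degH + ((Utors F n s m).couple.degG -
        j • (Utors F n s m).couple.degF) = (-1, -1 - (j : ℤ)) := by
      simp [GradedComplex.couple, sub_eq_add_neg]
    rw [hδ] at hi'
    simp only [Set.mem_insert_iff, Set.mem_singleton_iff, Prod.ext_iff, Prod.fst_add,
      Prod.snd_add] at hi hi'
    omega

theorem Utors_f_pow (n s : ℤ) (m : ℕ) (x : (Utors F n s m).couple.A) :
    ((Utors F n s m).couple.f ^ m) x = 0 := by
  have h : ∀ k (x : (Utors F n s m).H), ((Utors F n s m).fH ^ k) x = (X ^ k : F[X]) • x := by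
    intro k
    induction k with
    | zero => simp
    | succ k ih =>
      intro x
      rw [pow_succ', Module.End.mul_apply, ih, pow_succ', mul_smul]
      rfl
  refine (h m x).trans ?_
  obtain ⟨⟨⟨a, b⟩, hz⟩, rfl⟩ := DHomology.mk_surjective _ x
  refine (map_smul (DHomology.mk (Utors F n s m).d) _ _).symm.trans
    ((DHomology.mk_eq_zero _ _).2 ?_)
  have ha : X ^ m * a = 0 := congrArg Prod.snd hz
  have ha' : a = 0 := (mul_eq_zero.1 ha).resolve_left (pow_ne_zero m X_ne_zero)
  refine ⟨(b, 0), ?_⟩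
  subst ha'
  exact Prod.ext (mul_zero _).symm rfl

end FirstPage

/-! ### The homology of the elementary complexes -/

section ElementaryHomology

variable {F : Type u} [Field F]

theorem exists_eq_C_mul_X_pow {n s n' p : ℤ} {q : F[X]} (hq : q ∈ polyGr F n s (n', p))
    (h0 : q ≠ 0) : n' = n ∧ ∃ k : ℕ, p = s + k ∧ ∃ c : F, c ≠ 0 ∧ q = C c * X ^ k := by
  obtain ⟨k, hk⟩ : ∃ k, q.coeff k ≠ 0 := by
    by_contra! h
    exact h0 (Polynomial.ext h)
  have h1 := hq k hk
  simp only [Prod.mk.injEq] at h1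
  refine ⟨h1.1, k, by omega, q.coeff k, hk, ?_⟩
  ext l
  rw [coeff_C_mul_X_pow]
  split_ifs with h
  · rw [h]
  · by_contra hl
    have h2 := hq l hl
    simp only [Prod.mk.injEq] at h2
    omega

variable {M : Type v} [AddCommGroup M] [Module F[X] M] [Module F M] [IsScalarTower F F[X] M]

theorem C_mul_X_pow_smul (c : F) (k : ℕ) (e : M) :
    (C c * X ^ k : F[X]) • e = c • (X ^ k : F[X]) • e := by
  rw [← smul_eq_C_mul, smul_assoc]

/-- An element killed by `x ^ m` defines a map from `H(U_{n,s,m})`, which is a cyclic module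
generated in bidegree `(n, s)`, with basis the `x ^ k` for `k < m`. -/
theorem exists_hom_of_U (n s : ℤ) (m : WithTop ℕ+) (e : M)
    (he : ∀ j : ℕ+, m = j → (X ^ (j : ℕ) : F[X]) • e = 0) :
    ∃ φ : (U F n s m).H →ₗ[F[X]] M, e ∈ LinearMap.range φ ∧
      ∀ n' p, ∀ x ∈ (U F n s m).grH (n', p), x ≠ 0 → n' = n ∧ ∃ k : ℕ, p = s + k ∧
        (∀ j : ℕ+, m = j → k < j) ∧ ∃ c : F, c ≠ 0 ∧ φ x = c • (X ^ k : F[X]) • e := by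
  induction m using WithTop.recTopCoe with
  | top =>
    let K := Ufree F n s
    let φ : K.H →ₗ[F[X]] M := Submodule.liftQ _
      (LinearMap.toSpanSingleton F[X] M e ∘ₗ (LinearMap.ker K.d).subtype) (by
        rintro ⟨z, hz⟩ ⟨y, hy⟩
        have : z = 0 := hy.symm
        subst this
        exact map_zero _)
    have hφ : ∀ z, φ (DHomology.mk K.d z) = (z.1 : F[X]) • e := fun _ => rfl
    refine ⟨φ, ⟨DHomology.mk K.d ⟨(1 : F[X]), rfl⟩, (hφ _).trans (one_smul _ e)⟩, ?_⟩
    rintro n' p _ ⟨⟨z, hz'⟩, hz, rfl⟩ h0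
    obtain ⟨hn, k, hp, c, hc, hq⟩ := exists_eq_C_mul_X_pow hz fun h => h0 (by
      refine (congrArg (DHomology.mk K.d) (Subtype.ext ?_)).trans (map_zero _)
      exact h)
    refine ⟨hn, k, hp, fun j hj => absurd hj WithTop.top_ne_coe, c, hc, (hφ _).trans ?_⟩
    rw [← C_mul_X_pow_smul, ← hq]
    rfl
  | coe m =>
    let K := Utors F n s m
    let φ : K.H →ₗ[F[X]] M := Submodule.liftQ _
      (LinearMap.toSpanSingleton F[X] M e ∘ₗ LinearMap.snd F[X] F[X] F[X] ∘ₗ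
        (LinearMap.ker K.d).subtype) (by
        rintro ⟨z, hz⟩ ⟨y, hy⟩
        have : z.2 = X ^ (m : ℕ) * y.1 := (congrArg Prod.snd hy).symm
        change z.2 • e = 0
        rw [this, mul_comm, mul_smul, he m rfl, smul_zero])
    have hφ : ∀ z, φ (DHomology.mk K.d z) = (z.1.2 : F[X]) • e := fun _ => rfl
    refine ⟨φ, ⟨DHomology.mk K.d ⟨((0 : F[X]), (1 : F[X])), ?_⟩, (hφ _).trans (one_smul _ e)⟩, ?_⟩
    · exact Prod.ext rfl (mul_zero _)
    rintro n' p _ ⟨⟨⟨a, b⟩, hz'⟩, hz, rfl⟩ h0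
    have ha : X ^ (m : ℕ) * a = 0 := congrArg Prod.snd hz'
    have ha' : a = 0 := (mul_eq_zero.1 ha).resolve_left (pow_ne_zero _ X_ne_zero)
    subst ha'
    have hb : ¬ ∃ r, X ^ (m : ℕ) * r = b := by
      rintro ⟨r, rfl⟩
      exact h0 ((DHomology.mk_eq_zero K.d _).2 ⟨(r, 0), rfl⟩)
    obtain ⟨hn, k, hp, c, hc, hq⟩ := exists_eq_C_mul_X_pow hz.2 fun h : b = 0 =>
      hb ⟨0, by rw [h, mul_zero]⟩
    refine ⟨hn, k, hp, fun j hj => ?_, c, hc, (hφ _).trans ?_⟩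
    · rw [← WithTop.coe_injective hj]
      by_contra! hk
      refine hb ⟨C c * X ^ (k - m : ℕ), ?_⟩
      rw [show b = _ from hq, mul_left_comm, ← pow_add, Nat.add_sub_cancel' hk]
    · rw [← C_mul_X_pow_smul, ← hq]
      rfl

end ElementaryHomology

/-! ### Enumerating locally finite families -/

/-- A family with finitely many members of each degree, with degrees bounded below, can be
arranged in a finite or infinite sequence that is sorted lexicographically. -/
theorem exists_sorted_enumeration {A : Type*} {β : Type*} [LinearOrder β] (s : A → ℤ) (m : A → β)
    (hfin : ∀ t, {a | s a = t}.Finite) (s₀ : ℤ) (hs₀ : ∀ a, s₀ ≤ s a) :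
    ∃ (K : ℕ∞) (e : {i : ℕ // (i : ℕ∞) < K} ≃ A),
      ∀ i j, i ≤ j → s (e i) < s (e j) ∨ s (e i) = s (e j) ∧ m (e i) ≤ m (e j) := by
  have hc : Countable A := by
    rw [← Set.countable_univ_iff]
    refine Set.Countable.mono ?_ (Set.countable_iUnion fun t => (hfin t).countable)
    exact fun a _ => Set.mem_iUnion.2 ⟨s a, rfl⟩
  -- Ties are broken by an arbitrary injection into `ℕ`.
  obtain ⟨f, hf⟩ := hc.exists_injective_nat
  let key : A → ℤ ×ₗ (β ×ₗ ℕ) := fun a => toLex (s a, toLex (m a, f a))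
  have hkey : Function.Injective key := fun a b h =>
    hf (congrArg Prod.snd (toLex.injective (congrArg Prod.snd (toLex.injective h))))
  let _ : LinearOrder A := LinearOrder.lift' key hkey
  have hle : ∀ a b : A, a ≤ b → s a < s b ∨ s a = s b ∧ m a ≤ m b := by
    intro a b hab
    have h1 : key a ≤ key b := hab
    rw [Prod.Lex.le_iff] at h1
    refine h1.imp id fun h => ⟨h.1, ?_⟩
    have h2 := h.2
    rw [Prod.Lex.le_iff] at h2
    exact h2.elim le_of_lt fun h => le_of_eq h.1
  have hfin' : ∀ a : A, (Set.Iio a).Finite := by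
    intro a
    refine Set.Finite.subset ((Set.finite_Icc s₀ (s a)).biUnion fun t _ => hfin t) fun b hb => ?_
    refine Set.mem_biUnion (x := s b) ⟨hs₀ b, ?_⟩ rfl
    rcases hle b a (le_of_lt hb) with h | h
    · exact h.le
    · exact h.1.le
  let rank : A → ℕ := fun a => (hfin' a).toFinset.card
  have hrank : StrictMono rank := by
    intro a b hab
    refine Finset.card_lt_card (Finset.ssubset_iff_subset_ne.2 ⟨fun c hc => ?_, fun h => ?_⟩)
    · rw [Set.Finite.mem_toFinset] at hc ⊢
      exact lt_trans hc hab
    · have : a ∈ (hfin' a).toFinset := by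
        rw [h, Set.Finite.mem_toFinset]
        exact hab
      rw [Set.Finite.mem_toFinset] at this
      exact lt_irrefl a this
  -- The elements below `a` have distinct ranks below `rank a`, and there are `rank a` of them.
  have hlow : ∀ a, ∀ i ≤ rank a, ∃ b, rank b = i := by
    intro a i hi
    rcases hi.eq_or_lt with rfl | hi
    · exact ⟨a, rfl⟩
    have himg : (hfin' a).toFinset.image rank = Finset.range (rank a) := by
      refine Finset.eq_of_subset_of_card_le (fun j hj => ?_) ?_
      · obtain ⟨b, hb, rfl⟩ := Finset.mem_image.1 hj
        rw [Set.Finite.mem_toFinset] at hb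
        exact Finset.mem_range.2 (hrank hb)
      · rw [Finset.card_image_of_injective _ hrank.injective, Finset.card_range]
    have : i ∈ (hfin' a).toFinset.image rank := by
      rw [himg]
      exact Finset.mem_range.2 hi
    obtain ⟨b, -, hb⟩ := Finset.mem_image.1 this
    exact ⟨b, hb⟩
  have hK : ∀ i : ℕ, (i : ℕ∞) < ⨆ a, ((rank a + 1 : ℕ) : ℕ∞) ↔ ∃ a, rank a = i := by
    intro i
    rw [lt_iSup_iff]
    constructor
    · rintro ⟨a, ha⟩
      exact hlow a i (Nat.lt_succ_iff.1 (Nat.cast_lt.1 ha))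
    · rintro ⟨a, rfl⟩
      exact ⟨a, Nat.cast_lt.2 (Nat.lt_succ_self _)⟩
  let g : A → {i : ℕ // (i : ℕ∞) < ⨆ a, ((rank a + 1 : ℕ) : ℕ∞)} :=
    fun a => ⟨rank a, (hK _).2 ⟨a, rfl⟩⟩
  have hg : Function.Bijective g :=
    ⟨fun a b h => hrank.injective (congrArg Subtype.val h), fun i => by
      obtain ⟨a, ha⟩ := (hK i).1 i.2
      exact ⟨a, Subtype.ext ha⟩⟩
  refine ⟨_, (Equiv.ofBijective g hg).symm, fun i j hij => hle _ _ ?_⟩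
  obtain ⟨a, rfl⟩ := hg.2 i
  obtain ⟨b, rfl⟩ := hg.2 j
  have hab : a ≤ b := hrank.le_iff_le.1 hij
  rwa [show (Equiv.ofBijective g hg).symm (g a) = a from Equiv.ofBijective_symm_apply_apply g hg a,
    show (Equiv.ofBijective g hg).symm (g b) = b from Equiv.ofBijective_symm_apply_apply g hg b]

/-! ### Bases adapted to a filtration -/

/-- A subspace `W'` with an increasing sequence of subspaces `W k` has a basis such that each `W k`
is spanned by the basis vectors of index `≤ k`. -/
theorem exists_adapted_basis {F V : Type*} [Field F] [AddCommGroup V] [Module F V]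
    (W : ℕ+ → Submodule F V) (W' : Submodule F V) (hW : ∀ k, W k ≤ W') (hmono : Monotone W) :
    ∃ (B : Set V) (m : V → WithTop ℕ+), LinearIndepOn F id B ∧ B ⊆ W' ∧
      W' ≤ Submodule.span F B ∧ (∀ b ∈ B, ∀ k : ℕ+, m b = k → b ∈ W k) ∧
      ∀ k : ℕ+, W k ≤ Submodule.span F {b ∈ B | m b ≤ k} := by
  classical
  -- Linearly independent sets `S k`, each extending the preceding one to a basis of `W (k + 1)`.
  have step : ∀ (k : ℕ) (S : {S : Set V // LinearIndepOn F id S ∧ S ⊆ W k.succPNat}),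
      ∃ S' : {S : Set V // LinearIndepOn F id S ∧ S ⊆ W (k + 1).succPNat},
        S.1 ⊆ S'.1 ∧ (W (k + 1).succPNat : Set V) ⊆ Submodule.span F S'.1 := by
    rintro k ⟨S, hS, hSW⟩
    have hSW' : S ⊆ W (k + 1).succPNat := hSW.trans (hmono (by simp [← PNat.coe_le_coe]))
    obtain ⟨S', h1, h2, h3, h4⟩ := exists_linearIndepOn_id_extension hS hSW'
    exact ⟨⟨S', h4, h1⟩, h2, h3⟩
  obtain ⟨S₀, h1, -, h3, h4⟩ := exists_linearIndepOn_id_extension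
    (linearIndependent_empty F V) (Set.empty_subset (W (0 : ℕ).succPNat : Set V))
  choose next hnext hspan using step
  let S : ∀ k : ℕ, {S : Set V // LinearIndepOn F id S ∧ S ⊆ W k.succPNat} :=
    fun k => Nat.rec ⟨S₀, h4, h1⟩ next k
  have hS : Monotone fun k => (S k).1 := monotone_nat_of_le_succ fun k => hnext k (S k)
  have hSspan : ∀ k, (W k.succPNat : Set V) ⊆ Submodule.span F (S k).1 := by
    intro k
    cases k with
    | zero => exact h3
    | succ k => exact hspan k (S k)
  have hU : LinearIndepOn F id (⋃ k, (S k).1) :=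
    linearIndepOn_iUnion_of_directed hS.directed_le fun k => (S k).2.1
  have hUW : (⋃ k, (S k).1) ⊆ W' := Set.iUnion_subset fun k => (S k).2.2.trans (hW _)
  obtain ⟨B, g1, g2, g3, g4⟩ := exists_linearIndepOn_id_extension hU hUW
  let m : V → WithTop ℕ+ := fun b =>
    if h : ∃ k, b ∈ (S k).1 then ((Nat.find h).succPNat : ℕ+) else ⊤
  refine ⟨B, m, g4, g1, g3, fun b _ k hk => ?_, fun k => ?_⟩
  · by_cases h : ∃ k, b ∈ (S k).1
    · have hm : m b = ((Nat.find h).succPNat : ℕ+) := dif_pos h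
      rw [hm] at hk
      rw [← WithTop.coe_injective hk]
      exact (S _).2.2 (Nat.find_spec h)
    · have hm : m b = ⊤ := dif_neg h
      rw [hm] at hk
      exact absurd hk WithTop.top_ne_coe
  · have hk : k.natPred.succPNat = k := PNat.succPNat_natPred k
    intro v hv
    rw [← hk] at hv
    refine Submodule.span_mono ?_ (hSspan _ hv)
    intro b hb
    have h : ∃ k, b ∈ (S k).1 := ⟨_, hb⟩
    have hm : m b = ((Nat.find h).succPNat : ℕ+) := dif_pos h
    refine ⟨g2 (Set.mem_iUnion.2 h), ?_⟩
    rw [hm, WithTop.coe_le_coe, ← hk]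
    exact Nat.succPNat_le_succPNat.2 (Nat.find_min' h hb)

/-! ### The structure of graded `F[x]`-modules -/

section Structure

variable {F : Type u} [Field F] {M : Type v} [AddCommGroup M] [Module F[X] M] [Module F M]
  [IsScalarTower F F[X] M]

/-- The subspace `xM` of an `F[x]`-module `M`. -/
noncomputable def xRange (F : Type u) [Field F] (M : Type v) [AddCommGroup M] [Module F[X] M]
    [Module F M] [IsScalarTower F F[X] M] : Submodule F M :=
  LinearMap.range ((LinearMap.lsmul F[X] M X).restrictScalars F)

theorem X_pow_smul_mem {M : Type v} [AddCommGroup M] [Module F[X] M] [Module F M]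
    {gr : ℤ × ℤ → Submodule F M}
    (hX : ∀ n p, ∀ v ∈ gr (n, p), (X : F[X]) • v ∈ gr (n, p + 1)) {n p : ℤ} {v : M}
    (hv : v ∈ gr (n, p)) (k : ℕ) : (X ^ k : F[X]) • v ∈ gr (n, p + k) := by
  induction k with
  | zero => simpa using hv
  | succ k ih =>
    rw [pow_succ', mul_smul, Nat.cast_succ, ← add_assoc]
    exact hX _ _ _ ih

/-- Homogeneous elements `e a` decompose a graded `F[x]`-module `M` into cyclic modules `N a` with
annihilator `(x ^ m a)`, or `0` for `m a = ∞`, if in each bidegree their classes form a basis of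
`M / xM` that is adapted to the filtration by the classes of the elements killed by `x ^ k`. -/
theorem exists_iso_of_adapted {gr : ℤ × ℤ → Submodule F M} (hgr : DirectSum.IsInternal gr)
    (hX : ∀ n p, ∀ v ∈ gr (n, p), (X : F[X]) • v ∈ gr (n, p + 1))
    (hb : ∀ n, ∃ p₀, ∀ p ≤ p₀, gr (n, p) = ⊥)
    {ι : Type*} {N : ι → Type w} [∀ a, AddCommGroup (N a)] [∀ a, Module F[X] (N a)]
    [∀ a, Module F (N a)] [∀ a, IsScalarTower F F[X] (N a)] {G : ∀ a, ℤ × ℤ → Submodule F (N a)}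
    (hG : ∀ a, DirectSum.IsInternal (G a))
    (n s : ι → ℤ) (m : ι → WithTop ℕ+) (e : ι → M) (he : ∀ a, e a ∈ gr (n a, s a))
    (φ : ∀ a, N a →ₗ[F[X]] M) (hφe : ∀ a, e a ∈ LinearMap.range (φ a))
    (hφ : ∀ a, ∀ n' p, ∀ x ∈ G a (n', p), x ≠ 0 → n' = n a ∧ ∃ k : ℕ, p = s a + k ∧
      (∀ j : ℕ+, m a = j → k < j) ∧ ∃ c : F, c ≠ 0 ∧ φ a x = c • (X ^ k : F[X]) • e a)
    (hspan : ∀ i, ∀ v ∈ gr i, (xRange F M).mkQ v ∈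
      Submodule.span F ((fun a => (xRange F M).mkQ (e a)) '' {a | (n a, s a) = i}))
    (hind : ∀ i, LinearIndepOn F (fun a => (xRange F M).mkQ (e a)) {a | (n a, s a) = i})
    (hker : ∀ i, ∀ k : ℕ, ∀ v ∈ gr i, (X ^ k : F[X]) • v = 0 → (xRange F M).mkQ v ∈
      Submodule.span F ((fun a => (xRange F M).mkQ (e a)) ''
        {a | (n a, s a) = i ∧ ∃ j : ℕ+, m a = j ∧ (j : ℕ) ≤ k})) :
    ∃ Θ : M ≃ₗ[F[X]] DirectSum ι N,
      ∀ i, (gr i).map (Θ.toLinearMap.restrictScalars F) = sumGr G i := by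
  classical
  let Θ : DirectSum ι N →ₗ[F[X]] M :=
    DirectSum.toModule F[X] ι M φ
  have hΘ : ∀ x, Θ x = ∑ a ∈ DFinsupp.support x, φ a (x a) := by
    intro x
    conv_lhs => rw [← DirectSum.sum_support_of x]
    rw [map_sum]
    exact Finset.sum_congr rfl fun a _ => DirectSum.toModule_lof F[X] a (x a)
  have hI := sumGr_isInternal hG
  have hcoef : ∀ n' p, ∀ x ∈ sumGr G (n', p), ∀ a,
      x a ≠ 0 → n' = n a ∧ ∃ k : ℕ, p = s a + k ∧ (∀ j : ℕ+, m a = j → k < j) ∧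
        ∃ c : F, c ≠ 0 ∧ φ a (x a) = c • (X ^ k : F[X]) • e a :=
    fun n' p x hx a h0 => hφ a n' p (x a) (mem_sumGr.1 hx a) h0
  have hmap : ∀ i, ∀ x ∈ sumGr G i, Θ x ∈ gr i := by
    rintro ⟨n', p⟩ x hx
    rw [hΘ]
    refine Submodule.sum_mem _ fun a ha => ?_
    obtain ⟨rfl, k, rfl, -, c, -, h⟩ := hcoef n' p x hx a (DFinsupp.mem_support_iff.1 ha)
    rw [h]
    exact Submodule.smul_mem _ c (X_pow_smul_mem hX (he a) k)
  have hinj : ∀ i, ∀ x ∈ sumGr G i, Θ x = 0 → x = 0 := by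
    rintro ⟨n', p⟩ x hx hx0
    by_contra hne
    have hsupp : (DFinsupp.support x).Nonempty := by
      rw [Finset.nonempty_iff_ne_empty]
      exact fun h => hne (DFinsupp.support_eq_empty.1 h)
    -- The summands of maximal degree `s a₀` give the leading term of the relation `Θ x = 0`.
    obtain ⟨a₀, ha₀, hmax⟩ := Finset.exists_max_image _ s hsupp
    have hex : ∀ a, ∃ (k : ℕ) (c : F), x a ≠ 0 → n' = n a ∧ p = s a + k ∧
        (∀ j : ℕ+, m a = j → k < j) ∧ c ≠ 0 ∧ φ a (x a) = c • (X ^ k : F[X]) • e a := by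
      intro a
      by_cases h : x a = 0
      · exact ⟨0, 0, fun h' => absurd h h'⟩
      · obtain ⟨h1, k, h2, h3, c, h4, h5⟩ := hcoef n' p x hx a h
        exact ⟨k, c, fun _ => ⟨h1, h2, h3, h4, h5⟩⟩
    choose k c hkc using hex
    have hkc' : ∀ a ∈ DFinsupp.support x, _ := fun a ha => hkc a (DFinsupp.mem_support_iff.1 ha)
    have hk : ∀ a ∈ DFinsupp.support x, k a₀ ≤ k a := by
      intro a ha
      have h1 := (hkc' a ha).2.1
      have h2 := (hkc' a₀ ha₀).2.1
      have h3 := hmax a ha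
      omega
    let v : M := ∑ a ∈ DFinsupp.support x, c a • (X ^ (k a - k a₀) : F[X]) • e a
    have hv0 : (X ^ k a₀ : F[X]) • v = 0 := by
      rw [← hx0, hΘ, Finset.smul_sum]
      refine Finset.sum_congr rfl fun a ha => ?_
      rw [(hkc' a ha).2.2.2.2, smul_comm, smul_smul, ← pow_add, Nat.add_sub_cancel' (hk a ha)]
    have hv : v ∈ gr (n', s a₀) := by
      refine Submodule.sum_mem _ fun a ha => Submodule.smul_mem _ _ ?_
      have h1 := (hkc' a ha).2.1
      have h2 := (hkc' a₀ ha₀).2.1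
      have h3 := hk a ha
      have := X_pow_smul_mem hX (he a) (k a - k a₀)
      rwa [← (hkc' a ha).1, show s a + ((k a - k a₀ : ℕ) : ℤ) = s a₀ by omega] at this
    let l : ι →₀ F := ∑ a ∈ (DFinsupp.support x).filter fun a => s a = s a₀, Finsupp.single a (c a)
    have hl : l ∈ Finsupp.supported F F {a | (n a, s a) = (n', s a₀)} := by
      refine Submodule.sum_mem _ fun a ha => Finsupp.single_mem_supported F _ ?_
      rw [Finset.mem_filter] at ha
      exact Prod.ext (hkc' a ha.1).1.symm ha.2
    have hlv : Finsupp.linearCombination F (fun a => (xRange F M).mkQ (e a)) l =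
        (xRange F M).mkQ v := by
      rw [map_sum, map_sum, Finset.sum_filter]
      refine Finset.sum_congr rfl fun a ha => ?_
      rw [Finsupp.linearCombination_single, map_smul]
      have h1 := (hkc' a ha).2.1
      have h2 := (hkc' a₀ ha₀).2.1
      split_ifs with h
      · rw [show k a - k a₀ = 0 by omega, pow_zero, one_smul]
      · obtain ⟨j, hj⟩ : ∃ j, k a - k a₀ = j + 1 :=
          Nat.exists_eq_succ_of_ne_zero (by have := hk a ha; omega)
        have h0 : (xRange F M).mkQ ((X ^ (k a - k a₀) : F[X]) • e a) = 0 := by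
          rw [Submodule.mkQ_apply, Submodule.Quotient.mk_eq_zero]
          exact ⟨(X ^ j : F[X]) • e a, by rw [hj, pow_succ', mul_smul]; rfl⟩
        rw [h0, smul_zero]
    have hv' := hker _ (k a₀) v hv hv0
    rw [Finsupp.mem_span_image_iff_linearCombination] at hv'
    obtain ⟨l', hl', hlv'⟩ := hv'
    have hll' : l = l' := linearIndepOn_iffₛ.1 (hind (n', s a₀)) l hl l'
      (Finsupp.supported_mono (fun a ha => ha.1) hl') (hlv.trans hlv'.symm)
    have h1 : l a₀ = c a₀ := by
      rw [Finsupp.finsetSum_apply, Finset.sum_eq_single a₀]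
      · exact Finsupp.single_eq_same
      · exact fun a _ ha => Finsupp.single_eq_of_ne (Ne.symm ha)
      · exact fun h => (h (Finset.mem_filter.2 ⟨ha₀, rfl⟩)).elim
    have h2 : l' a₀ = 0 := by
      by_contra h
      obtain ⟨-, j, hj, hjk⟩ := hl' (Finsupp.mem_support_iff.2 h)
      exact absurd ((hkc' a₀ ha₀).2.2.1 j hj) (not_lt.2 hjk)
    exact (hkc' a₀ ha₀).2.2.2.1 (by rw [← h1, hll', h2])
  have hsurj : ∀ n' p, ∀ v ∈ gr (n', p), v ∈ LinearMap.range Θ := by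
    intro n'
    obtain ⟨p₀, hp₀⟩ := hb n'
    have key : ∀ k : ℕ, ∀ v ∈ gr (n', p₀ + k), v ∈ LinearMap.range Θ := by
      intro k
      induction k with
      | zero =>
        intro v hv
        rw [hp₀ _ (by simp), Submodule.mem_bot] at hv
        rw [hv]
        exact Submodule.zero_mem _
      | succ k ih =>
        intro v hv
        have h1 := hspan _ v hv
        have himg : (fun a => (xRange F M).mkQ (e a)) '' {a | (n a, s a) = (n', p₀ + (k + 1 : ℕ))} =
            (xRange F M).mkQ '' (e '' {a | (n a, s a) = (n', p₀ + (k + 1 : ℕ))}) :=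
          (Set.image_image _ _ _).symm
        rw [himg, Submodule.span_image] at h1
        obtain ⟨w, hw, hwv⟩ := h1
        have hw1 : w ∈ gr (n', p₀ + (k + 1 : ℕ)) := by
          refine (Submodule.span_le.2 ?_) hw
          rintro _ ⟨a, ha, rfl⟩
          have := he a
          rwa [show (n a, s a) = _ from ha] at this
        have hw2 : w ∈ (LinearMap.range Θ).restrictScalars F := by
          refine (Submodule.span_le.2 ?_) hw
          rintro _ ⟨a, -, rfl⟩
          obtain ⟨y, hy⟩ := hφe a
          exact ⟨DirectSum.lof F[X] ι _ a y, (DirectSum.toModule_lof F[X] a y).trans hy⟩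
        rw [← sub_eq_zero, ← map_sub, Submodule.mkQ_apply, Submodule.Quotient.mk_eq_zero] at hwv
        obtain ⟨y, hy⟩ := hwv
        have hy' : (X : F[X]) • proj hgr (n', p₀ + k) y = w - v := by
          have h2 := proj_map hgr hgr ((LinearMap.lsmul F[X] M X).restrictScalars F) (0, 1)
            (fun i v hv => by
              rw [show i + (0, 1) = (i.1, i.2 + 1) from Prod.ext (add_zero _) rfl]
              exact hX i.1 i.2 v hv) (n', p₀ + k) y
          refine h2.symm.trans ?_
          rw [hy]
          refine (mem_iff_proj_eq hgr).1 ?_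
          have := Submodule.sub_mem _ hw1 hv
          simpa [add_assoc] using this
        have h3 : v = w - (X : F[X]) • proj hgr (n', p₀ + k) y := by rw [hy']; abel
        rw [h3]
        exact Submodule.sub_mem _ hw2 (Submodule.smul_mem _ _ (ih _ (proj_mem hgr _ y)))
    intro p v hv
    by_cases hp : p ≤ p₀
    · rw [hp₀ p hp, Submodule.mem_bot] at hv
      rw [hv]
      exact Submodule.zero_mem _
    · refine key (p - p₀).toNat v ?_
      rwa [show p₀ + ((p - p₀).toNat : ℤ) = p by omega]
  have hbij : Function.Bijective Θ := by
    constructor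
    · rw [injective_iff_map_eq_zero]
      intro x hx
      refine proj_ext hI fun i => ?_
      rw [map_zero]
      refine hinj i _ (proj_mem hI i x) ?_
      have := proj_map hI hgr (Θ.restrictScalars F) 0
        (fun i x hx => by rw [add_zero]; exact hmap i x hx) i x
      refine this.symm.trans ?_
      rw [LinearMap.restrictScalars_apply, hx, map_zero]
    · intro v
      exact homogeneous_induction hgr (P := fun v => v ∈ LinearMap.range Θ) v
        (fun i v hv => hsurj i.1 i.2 v hv) (Submodule.zero_mem _)
        fun v w hv hw => Submodule.add_mem _ hv hw
  let E := LinearEquiv.ofBijective Θ hbij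
  have hE := map_gr_eq_of_le hI hgr (E.restrictScalars F) hmap
  rw [map_gr_iff] at hE
  refine ⟨E.symm, map_gr_iff (e := (E.restrictScalars F).symm).2 fun i v => ?_⟩
  rw [← hE]
  simp

/-- A graded `F[x]`-module whose homogeneous components are finite dimensional, and vanish in low
degrees, is a direct sum of cyclic modules. -/
theorem exists_decompData {gr : ℤ × ℤ → Submodule F M} (hgr : DirectSum.IsInternal gr)
    (hX : ∀ n p, ∀ v ∈ gr (n, p), (X : F[X]) • v ∈ gr (n, p + 1))
    (hb : ∀ n, ∃ p₀, ∀ p ≤ p₀, gr (n, p) = ⊥) (hfin : ∀ i, FiniteDimensional F (gr i)) :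
    ∃ (D : DecompData) (Θ : M ≃ₗ[F[X]] DirectSum D.Idx fun a => (D.summand F a).H),
      ∀ i, (gr i).map (Θ.toLinearMap.restrictScalars F) =
        sumGr (fun a => (D.summand F a).grH) i := by
  let q := (xRange F M).mkQ
  let W : ℤ × ℤ → ℕ+ → Submodule F (M ⧸ xRange F M) := fun i k =>
    (gr i ⊓ LinearMap.ker ((LinearMap.lsmul F[X] M (X ^ (k : ℕ))).restrictScalars F)).map q
  have hWmono : ∀ i, Monotone (W i) := by
    intro i k l hkl
    refine Submodule.map_mono fun v hv => ⟨hv.1, ?_⟩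
    have hv2 : (X ^ (k : ℕ) : F[X]) • v = 0 := hv.2
    have hkl' : (k : ℕ) ≤ l := hkl
    change (X ^ (l : ℕ) : F[X]) • v = 0
    rw [← Nat.sub_add_cancel hkl', pow_add, mul_smul, hv2, smul_zero]
  choose B m hBind hBsub hBspan hBm hBW using fun i =>
    exists_adapted_basis (W i) ((gr i).map q) (fun k => Submodule.map_mono inf_le_left) (hWmono i)
  have hlift : ∀ i b, ∃ e : M, b ∈ B i → e ∈ gr i ∧ q e = b ∧
      ∀ j : ℕ+, m i b = j → (X ^ (j : ℕ) : F[X]) • e = 0 := by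
    intro i b
    by_cases hbB : b ∈ B i
    · by_cases hj : ∃ j : ℕ+, m i b = j
      · obtain ⟨j, hj⟩ := hj
        obtain ⟨e, he, heb⟩ := hBm i b hbB j hj
        refine ⟨e, fun _ => ⟨he.1, heb, fun l hl => ?_⟩⟩
        rw [WithTop.coe_injective (hl.symm.trans hj)]
        exact he.2
      · obtain ⟨e, he, heb⟩ := hBsub i hbB
        exact ⟨e, fun _ => ⟨he, heb, fun j h => absurd ⟨j, h⟩ hj⟩⟩
    · exact ⟨0, fun h => absurd h hbB⟩
  choose e he using hlift
  have hBfin : ∀ i, (B i).Finite := by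
    intro i
    have hle : Submodule.span F (B i) ≤ (gr i).map q := Submodule.span_le.2 (hBsub i)
    have : FiniteDimensional F (Submodule.span F (B i)) :=
      Submodule.finiteDimensional_of_le hle
    have hB : LinearIndependent F
        fun b : B i => (⟨b, Submodule.subset_span b.2⟩ : Submodule.span F (B i)) :=
      LinearIndependent.of_comp (Submodule.span F (B i)).subtype (hBind i)
    exact hB.finite
  let A : ℤ → Type v := fun n => {x : ℤ × (M ⧸ xRange F M) // x.2 ∈ B (n, x.1)}
  have hA : ∀ n, ∃ (K : ℕ∞) (e : {i : ℕ // (i : ℕ∞) < K} ≃ A n), ∀ i j, i ≤ j →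
      (e i).1.1 < (e j).1.1 ∨ (e i).1.1 = (e j).1.1 ∧
        m (n, (e i).1.1) (e i).1.2 ≤ m (n, (e j).1.1) (e j).1.2 := by
    intro n
    obtain ⟨p₀, hp₀⟩ := hb n
    refine exists_sorted_enumeration (fun a : A n => a.1.1) (fun a => m (n, a.1.1) a.1.2)
      (fun t => ?_) p₀ fun a => ?_
    · refine Set.Finite.of_finite_image (f := fun a : A n => a.1.2)
        ((hBfin (n, t)).subset ?_) ?_
      · rintro _ ⟨a, rfl, rfl⟩
        exact a.2
      · intro a ha b hb hab
        exact Subtype.ext (Prod.ext (ha.trans hb.symm) hab)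
    · by_contra! hlt
      have h1 := hBsub _ a.2
      rw [hp₀ _ hlt.le, Submodule.map_bot] at h1
      have h2 : a.1.2 = 0 := h1
      have h3 := (hBind (n, a.1.1)).ne_zero a.2
      exact h3 h2
  choose K E hE using hA
  let D : DecompData :=
    { K := K
      s := fun n i => (E n i).1.1
      m := fun n i => m (n, (E n i).1.1) (E n i).1.2
      finite := fun n t => by
        refine Set.Finite.of_finite_image (f := fun i => (E n i).1.2)
          ((hBfin (n, t)).subset ?_) ?_
        · rintro _ ⟨i, rfl, rfl⟩
          exact (E n i).2
        · intro i hi j hj hij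
          exact (E n).injective (Subtype.ext (Prod.ext (hi.trans hj.symm) hij))
      s_mono := fun n i j hij => (hE n i j hij).elim le_of_lt fun h => h.1.le
      m_mono := fun n i j hij h => (hE n i j hij).elim (fun h' => absurd h h'.ne) fun h => h.2 }
  let vec : D.Idx → M ⧸ xRange F M := fun a => (E a.1 a.2).1.2
  have hvec : ∀ a : D.Idx, vec a ∈ B (a.1, D.s a.1 a.2) := fun a => (E a.1 a.2).2
  let gen : D.Idx → M := fun a => e (a.1, D.s a.1 a.2) (vec a)
  have hgen : ∀ a : D.Idx, q (gen a) = vec a := fun a => (he _ _ (hvec a)).2.1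
  have himage : ∀ i, ∀ P : WithTop ℕ+ → Prop, {b ∈ B i | P (m i b)} ⊆
      (fun a => q (gen a)) '' {a | (a.1, D.s a.1 a.2) = i ∧ P (D.m a.1 a.2)} := by
    rintro ⟨n, p⟩ P b ⟨hbB, hbP⟩
    let x : A n := ⟨(p, b), hbB⟩
    have hx : E n ((E n).symm x) = x := (E n).apply_symm_apply x
    refine ⟨⟨n, (E n).symm x⟩, ⟨?_, ?_⟩, (hgen _).trans ?_⟩
    · exact Prod.ext rfl (congrArg (fun y : A n => y.1.1) hx)
    · refine (congrArg (fun y : A n => P (m (n, y.1.1) y.1.2)) hx).mpr hbP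
    · exact congrArg (fun y : A n => y.1.2) hx
  choose φ hφe hφ using fun a : D.Idx =>
    exists_hom_of_U a.1 (D.s a.1 a.2) (D.m a.1 a.2) (gen a) (he _ _ (hvec a)).2.2
  refine ⟨D, exists_iso_of_adapted hgr hX hb (fun a => (D.summand F a).couple.grA_isInternal)
    (fun a : D.Idx => a.1) (fun a => D.s a.1 a.2) (fun a => D.m a.1 a.2) gen
    (fun a => (he _ _ (hvec a)).1) φ hφe hφ (fun i v hv => ?_) (fun i => ?_) fun i k v hv hk => ?_⟩
  · refine Submodule.span_mono ?_ (hBspan i (Submodule.mem_map_of_mem hv))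
    exact fun b hb => Set.image_mono (fun a ha => ha.1) (himage i (fun _ => True) ⟨hb, trivial⟩)
  · have hcongr : ∀ a : D.Idx, (xRange F M).mkQ (gen a) = vec a := hgen
    simp only [hcongr]
    refine LinearIndepOn.comp_of_image (v := id) (f := vec) ((hBind i).mono ?_) ?_
    · rintro _ ⟨a, rfl, rfl⟩
      exact hvec a
    · rintro ⟨n, j⟩ rfl ⟨n', j'⟩ hj' hv
      obtain rfl : n' = n := congrArg Prod.fst hj'
      have h1 : (E n' j').1.1 = (E n' j).1.1 := congrArg Prod.snd hj'
      rw [(E n').injective (Subtype.ext (Prod.ext h1.symm hv))]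
  · rcases Nat.eq_zero_or_pos k with rfl | hk0
    · rw [pow_zero, one_smul] at hk
      rw [hk, map_zero]
      exact Submodule.zero_mem _
    · lift k to ℕ+ using hk0
      have h1 := hBW i k (Submodule.mem_map_of_mem ⟨hv, hk⟩)
      refine Submodule.span_mono ?_ h1
      refine (himage i fun t => t ≤ k).trans (Set.image_mono fun a ha => ⟨ha.1, ?_⟩)
      obtain ⟨j, hj⟩ := WithTop.ne_top_iff_exists.1
        (ne_top_of_le_ne_top WithTop.coe_ne_top ha.2)
      refine ⟨j, hj.symm, ?_⟩
      have h2 := ha.2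
      rw [← hj, WithTop.coe_le_coe] at h2
      exact h2

end Structure

/-! ### Persistent homology -/

namespace FilteredComplex

variable {F : Type u} [Field F] (C : FilteredComplex.{u, v} F)

theorem PC_gr_finite (hf : C.LocallyFinite) (i : ℤ × ℤ) : FiniteDimensional F (C.PC.gr i) := by
  have := hf i.2 i.1
  have h1 : FiniteDimensional F (C.grTotal i) :=
    inferInstanceAs (FiniteDimensional F (LinearMap.range (C.inj i.1 i.2)))
  exact Module.Finite.map (C.grTotal i) (Module.AEval'.of C.shift).toLinearMap

theorem PC_gr_eq_bot {n p : ℤ} (h : C.fil p n = ⊥) : C.PC.gr (n, p) = ⊥ := by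
  have h1 : C.grTotal (n, p) = ⊥ := by
    refine (Submodule.eq_bot_iff _).2 ?_
    rintro _ ⟨⟨c, hc⟩, rfl⟩
    have hc' : c = 0 := by
      have hc2 : c ∈ C.fil p n := hc
      rwa [h] at hc2
    subst hc'
    exact map_zero (C.inj n p)
  change (C.grTotal (n, p)).map (Module.AEval'.of C.shift).toLinearMap = ⊥
  rw [h1, Submodule.map_bot]

theorem exists_homologyDecomp (hb : C.BoundedBelow) (hf : C.LocallyFinite) :
    ∃ D : DecompData, Nonempty (HomologyDecomp C.PC (D.summand F)) := by
  suffices h : ∃ (D : DecompData) (Θ : C.PC.H ≃ₗ[F[X]] DirectSum D.Idx fun a => (D.summand F a).H),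
      ∀ i, (C.PC.grH i).map (Θ.toLinearMap.restrictScalars F) =
        sumGr (fun a => (D.summand F a).grH) i by
    obtain ⟨D, Θ, hΘ⟩ := h
    exact ⟨D, ⟨⟨Θ, hΘ⟩⟩⟩
  refine exists_decompData C.PC.couple.grA_isInternal ?_ ?_ ?_
  · rintro n p _ ⟨z, hz, rfl⟩
    exact ⟨(X : F[X]) • z, C.PC.X_smul_mem n p z hz, rfl⟩
  · intro n
    obtain ⟨p₀, hp₀⟩ := hb n
    refine ⟨p₀, fun p hp => (Submodule.eq_bot_iff _).2 ?_⟩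
    rintro _ ⟨z, hz, rfl⟩
    have hz' : (z : C.PC.carrier) ∈ C.PC.gr (n, p) := hz
    rw [C.PC_gr_eq_bot (le_bot_iff.1 ((C.mono p p₀ n hp).trans hp₀.le)), Submodule.mem_bot] at hz'
    rw [show z = 0 from Subtype.ext hz', map_zero]
  · intro i
    have := C.PC_gr_finite hf i
    let j : (C.PC.gr i).comap ((LinearMap.ker C.PC.d).subtype.restrictScalars F) →ₗ[F] C.PC.gr i :=
      ((LinearMap.ker C.PC.d).subtype.restrictScalars F).restrict fun z hz => hz
    have : FiniteDimensional F
        ((C.PC.gr i).comap ((LinearMap.ker C.PC.d).subtype.restrictScalars F)) :=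
      FiniteDimensional.of_injective j fun a b hab =>
        Subtype.ext (Subtype.ext (congrArg Subtype.val hab : (j a : C.PC.carrier) = j b))
    exact Module.Finite.map ((C.PC.gr i).comap ((LinearMap.ker C.PC.d).subtype.restrictScalars F))
      ((DHomology.mk C.PC.d).restrictScalars F)

end FilteredComplex
end PHSS

theorem theorem1p5 {F : Type u} [Field F] (C : FilteredComplex.{u, v} F)
    (hb : C.BoundedBelow) (hf : C.LocallyFinite) :
    (∃ D : DecompData, Nonempty (HomologyDecomp C.PC (D.summand F))) ∧
    (∀ (D : DecompData) (Φ : HomologyDecomp C.PC (D.summand F)),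
      ∃ Ψ : SpectralDecomp C.PC (D.summand F), Ψ.InducedBy Φ) ∧
    (∀ n s : ℤ,
      (∀ k : ℕ, BigradedIso ((U F n s ⊤).grPage k) (lineGr F n s)) ∧
      BigradedIso (U F n s ⊤).grPageInf (lineGr F n s)) ∧
    (∀ (n s : ℤ) (m : ℕ+),
      (∀ k : ℕ, k + 1 ≤ (m : ℕ) → BigradedIso ((U F n s m).grPage k)
        (fun i => (lineGr F (n + 1) (s + (m : ℕ)) i).prod (lineGr F n s i))) ∧
      (∀ k : ℕ, (m : ℕ) < k + 1 → Subsingleton ((U F n s m).page k)) ∧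
      Subsingleton (U F n s m).pageInf) := by
  refine ⟨C.exists_homologyDecomp hb hf, fun D Φ => Φ.exists_inducedBy,
    fun n s => ⟨fun k => ?_, ?_⟩, fun n s m => ?_⟩
  · exact (ExactCouple.bigradedIso_of_d_eq_zero k fun j _ => Ufree_iter_d n s j).trans
      (Ufree_grE n s)
  · exact (ExactCouple.grEinf_bigradedIso (Ufree_iter_d n s)).trans (Ufree_grE n s)
  · have hE : ∀ k : ℕ, (m : ℕ) < k + 1 → Subsingleton ((Utors F n s m).couple.iter k).E :=
      fun k hk => ExactCouple.subsingleton_E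
        (ExactCouple.subsingleton_iter_A (Utors_f_pow n s m) (Nat.lt_succ_iff.1 hk))
    refine ⟨fun k hk => ?_, hE, ExactCouple.subsingleton_Einf (hE m (Nat.lt_succ_self _))⟩
    exact (ExactCouple.bigradedIso_of_d_eq_zero k fun j hj => Utors_iter_d n s (by omega)).trans
      (Utors_grE n s m.pos)
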